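/- Let $n,k$ be integers with $3\le k\le n-1$. The $(n,k)$-bubble-sort graph $B_{n,k}$ is the simple graph whose vertices are the sequences $a_1a_2\cdots a_k$ of $k$ distinct elements of $\{1,\dots,n\}$, where $a_1\cdots a_k$ and $b_1\cdots b_k$ are adjacent if and only if either (a) there is $m\in\{2,\dots,k\}$ with $a_{m-1}=b_m$, $a_m=b_{m-1}$ and $a_i=b_i$ for all $i\notin\{m-1,m\}$, or (b) $a_1\ne b_1$ and $a_i=b_i$ for all $i\neq 1$. For a graph $G$ and $S\subseteq V(G)$ let $\kappa_G(S)$ be the maximum number $r$ of pairwise edge-disjoint trees $T_1,\dots,T_r$ in $G$, each containing all vertices of $S$, such that $V(T_i)\cap V(T_j)=S$ for all $i\ne j$. The generalized $3$-connectivity of $G$ is $\kappa_3(G)=\min\{\kappa_G(S) : S\subseteq V(G),\ |S|=3\}$. Then $\kappa_3(B_{n,k})=n-2$. -/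

import Mathlib

/-- The `(n,k)`-bubble-sort graph `B_{n,k}`. Its vertices are the arrangements `a_0 a_1 ... a_{k-1}`
of `k` distinct symbols out of `n` (positions and symbols are counted from `0`). Two arrangements
are adjacent iff one arises from the other (a) by exchanging the symbols at two consecutive
positions, or (b) by replacing the symbol at the first position by a different one. -/
def bubbleSortGraph (n k : ℕ) : SimpleGraph (Fin k ↪ Fin n) where
  Adj a b :=
    (∃ p q : Fin k, q.val = p.val + 1 ∧ a p = b q ∧ a q = b p ∧
      ∀ i : Fin k, i ≠ p → i ≠ q → a i = b i) ∨
    (∃ p : Fin k, p.val = 0 ∧ a p ≠ b p ∧ ∀ i : Fin k, i ≠ p → a i = b i)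
  symm := ⟨by
    rintro a b (⟨p, q, hpq, h1, h2, h3⟩ | ⟨p, hp, h1, h2⟩)
    · exact Or.inl ⟨p, q, hpq, h2.symm, h1.symm, fun i hp hq => (h3 i hp hq).symm⟩
    · exact Or.inr ⟨p, hp, h1.symm, fun i hi => (h2 i hi).symm⟩⟩
  loopless := ⟨by
    rintro a (⟨p, q, hpq, h1, -, -⟩ | ⟨p, -, h1, -⟩)
    · have h := a.injective h1
      rw [h] at hpq
      omega
    · exact h1 rfl⟩

/-- The subgraphs `T 0, ..., T (r-1)` of `G` are trees containing all vertices of `S`, they are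
pairwise edge-disjoint, and any two of them have exactly the vertices of `S` in common. -/
def IsInternallyDisjointTrees {V : Type*} (G : SimpleGraph V) (S : Finset V) {r : ℕ}
    (T : Fin r → G.Subgraph) : Prop :=
  (∀ i, (T i).coe.IsTree ∧ (S : Set V) ⊆ (T i).verts) ∧
  (∀ i j, i ≠ j →
    (T i).verts ∩ (T j).verts = (S : Set V) ∧ Disjoint (T i).edgeSet (T j).edgeSet)

/-- `κ_G(S)`: the maximum number of internally disjoint trees in `G` connecting `S`
(with value `⊤` if there are arbitrarily many of them). -/
noncomputable def treeConnectivity {V : Type*} (G : SimpleGraph V) (S : Finset V) : ℕ∞ :=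
  ⨆ (r : ℕ) (_ : ∃ T : Fin r → G.Subgraph, IsInternallyDisjointTrees G S T), (r : ℕ∞)

/-- The generalized `k`-connectivity `κ_k(G)`: the minimum of `κ_G(S)` over all sets `S` of
exactly `k` vertices of `G`. -/
noncomputable def generalizedConnectivity {V : Type*} (k : ℕ) (G : SimpleGraph V) : ℕ∞ :=
  ⨅ (S : Finset V) (_ : S.card = k), treeConnectivity G S

/-! Upper bound. Every vertex has degree at most `n - 1`. Let `x`, `y` be adjacent and `z` a third
vertex. If `n - 1` trees connected them, each tree would use exactly one edge at `x` and exactly one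
at `y`; the tree through the edge `xy` would then never leave `{x, y}` and would miss `z`
(`lt_of_isInternallyDisjointTrees`).

Lower bound, by induction on the length of the arrangements (`connIn_and_hasFamily`). Write `d = n -
2`. The last symbol splits the graph into `d + 2` cells, each a copy of the graph with one symbol
and one position fewer, hence `d`-connected by induction. Exchanging the last two symbols gives each
vertex a unique partner in another cell, and every two cells are joined by such an edge.
`IsCellular` records just this, and from it `d` trees are built. If the three vertices share a cell,
induction gives `d - 1` trees inside it and the connected complement of the cell carries one more.
If exactly two share a cell, disjoint paths between them are continued through partners by a fan to
the third vertex. If they lie in three cells, each of the other `d - 1` cells is the core of one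
tree, and one path through the three cells is the last tree.

The disjoint paths come from Menger's theorem. Paths and trees are replaced throughout by connected
vertex sets and connected subgraphs; spanning trees are taken only at the end
(`IsConnectedFamily.exists_trees`). -/

open Set

/-! ### Walks inside a vertex set. -/

namespace SimpleGraph

variable {V : Type*} {G H : SimpleGraph V} {U W : Set V} {a b v : V}

/-- `G.Joined U a b`: there is a walk of `G` from `a` to `b` all of whose vertices lie in `U`. -/
inductive Joined (G : SimpleGraph V) (U : Set V) (a : V) : V → Prop
  | refl (ha : a ∈ U) : Joined G U a a
  | tail {b c : V} (h : Joined G U a b) (hbc : G.Adj b c) (hc : c ∈ U) : Joined G U a c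

namespace Joined

theorem mem_left (h : G.Joined U a b) : a ∈ U := by
  induction h with
  | refl ha => exact ha
  | tail _ _ _ ih => exact ih

theorem mem_right (h : G.Joined U a b) : b ∈ U := by
  cases h with
  | refl ha => exact ha
  | tail _ _ hc => exact hc

theorem mono (h : G.Joined U a b) (hUW : U ⊆ W) : G.Joined W a b := by
  induction h with
  | refl ha => exact refl (hUW ha)
  | tail _ hbc hc ih => exact tail ih hbc (hUW hc)

theorem mono_graph (h : G.Joined U a b) (hGH : G ≤ H) : H.Joined U a b := by
  induction h with
  | refl ha => exact refl ha
  | tail _ hbc hc ih => exact tail ih (hGH hbc) hc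

theorem trans {c : V} (h : G.Joined U a b) (h' : G.Joined U b c) : G.Joined U a c := by
  induction h' with
  | refl _ => exact h
  | tail _ hbc hc ih => exact tail ih hbc hc

theorem of_adj (h : G.Adj a b) (ha : a ∈ U) (hb : b ∈ U) : G.Joined U a b :=
  tail (refl ha) h hb

theorem symm (h : G.Joined U a b) : G.Joined U b a := by
  induction h with
  | refl ha => exact refl ha
  | tail h hbc hc ih => exact (of_adj hbc.symm hc h.mem_right).trans ih

/-- A walk stays in a set that it cannot leave. -/
theorem mem_of_closed {R : Set V} (h : G.Joined U a b) (ha : a ∈ R)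
    (hR : ∀ u ∈ R, ∀ w ∈ U, G.Adj u w → w ∈ R) : b ∈ R := by
  induction h with
  | refl _ => exact ha
  | tail _ hbc hc ih => exact hR _ ih _ hc hbc

/-- All vertices of a walk are themselves reached by the walk. -/
theorem restrict (h : G.Joined U a b) : G.Joined {u | G.Joined U a u} a b := by
  induction h with
  | refl ha => exact refl (refl ha)
  | tail h hbc hc ih => exact tail ih hbc (tail h hbc hc)

/-- The set `P` stands in for a path ending in `b`: deleting the end leaves the rest attached to
`a`. It consists of `b` and all that `a` reaches within `U` without passing through `b`. -/
theorem exists_path (h : G.Joined U a b) :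
    ∃ P ⊆ U, a ∈ P ∧ b ∈ P ∧ G.Joined P a b ∧ ∀ u ∈ P, u ≠ b → G.Joined (P \ {b}) a u := by
  set R : Set V := {u | G.Joined (U \ {b}) a u} with hR
  have key : ∀ u, G.Joined U a u → u ∈ R ∨ G.Joined (insert b R) a b := by
    intro u hu
    induction hu with
    | refl ha =>
      by_cases hab : a = b
      · subst hab
        exact Or.inr (refl (mem_insert _ _))
      · exact Or.inl (refl ⟨ha, hab⟩)
    | @tail v w _ hvw hw ih =>
      rcases ih with ih | ih
      · by_cases hwb : w = b
        · subst hwb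
          exact Or.inr (tail ((restrict ih).mono (subset_insert _ _)) hvw (mem_insert _ _))
        · exact Or.inl (tail ih hvw ⟨hw, hwb⟩)
      · exact Or.inr ih
  have hb : b ∉ R := fun hb => (mem_right hb).2 rfl
  have hj : G.Joined (insert b R) a b := (key b h).resolve_left hb
  refine ⟨insert b R, ?_, hj.mem_left, mem_insert _ _, hj, ?_⟩
  · rintro u (rfl | hu)
    · exact h.mem_right
    · exact (mem_right hu).1
  · rintro u (rfl | hu) hub
    · exact absurd rfl hub
    · exact (restrict hu).mono fun w hw => ⟨Or.inr hw, fun hwb => hb (hwb ▸ hw)⟩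

end Joined

/-! ### Menger's theorem, after Göring. -/

/-- Crossing into `insert x X` already happens without the edge `xy`, if `X` separates `A` from
both `B` and `y` in the graph without this edge. -/
theorem exists_joined_insert {A B X Y : Set V} {x y : V}
    (hG : ∀ u w, G.Adj u w → H.Adj u w ∨ (u = x ∧ w = y) ∨ (u = y ∧ w = x))
    (hsep : ∀ a ∈ A, ∀ b ∈ B, ¬ H.Joined Xᶜ a b) (hy : ∀ a ∈ A, ¬ H.Joined Xᶜ a y)
    (h : ∃ a ∈ A, ∃ b ∈ B, G.Joined Yᶜ a b) :
    ∃ a ∈ A, ∃ t ∈ insert x X, H.Joined Yᶜ a t := by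
  by_contra! hno
  obtain ⟨a, ha, b, hb, hab⟩ := h
  have key : ∀ u, H.Joined Yᶜ a u → H.Joined Xᶜ a u := fun u hu =>
    hu.restrict.mono fun w hw hwX => hno a ha w (mem_insert_of_mem _ hwX) hw
  refine hsep a ha b hb (key b (hab.mem_of_closed (R := {u | H.Joined Yᶜ a u})
    (Joined.refl hab.mem_left) fun u hu w hw huw => ?_))
  rcases hG u w huw with h | ⟨rfl, rfl⟩ | ⟨rfl, rfl⟩
  · exact Joined.tail hu h hw
  · exact absurd hu (hno a ha _ (mem_insert _ _))
  · exact absurd (key _ hu) (hy a ha)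

/-- A disjoint system of `A`-`T` paths, one for each `t ∈ T`, meeting `T` in `t` only. -/
theorem exists_paths_of_card_eq {A : Set V} {T : Finset V}
    (h : ∃ P : Fin T.card → Set V, Pairwise (fun i j => Disjoint (P i) (P j)) ∧
      ∀ i, ∃ a ∈ A, ∃ t ∈ T, G.Joined (P i) a t) :
    ∃ P : V → Set V, (∀ s ∈ T, ∀ t ∈ T, s ≠ t → Disjoint (P s) (P t)) ∧
      ∀ t ∈ T, t ∈ P t ∧ (∃ a ∈ A, G.Joined (P t) a t) ∧
        ∀ u ∈ P t, u ≠ t → ∃ a ∈ A, G.Joined (P t \ {t}) a u := by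
  obtain ⟨P, hP, hj⟩ := h
  choose a ha t ht hj using hj
  have tinj : Function.Injective (fun i => (⟨t i, ht i⟩ : T)) := by
    intro i j hij
    by_contra hne
    have : t i = t j := congrArg Subtype.val hij
    exact Set.disjoint_left.1 (hP hne) (hj i).mem_right (this ▸ (hj j).mem_right)
  have tsurj := ((Fintype.bijective_iff_injective_and_card _).2 ⟨tinj, by simp⟩).2
  have hex : ∀ s : V, ∃ Q : Set V, s ∈ T → ∃ i, t i = s ∧ Q ⊆ P i ∧ s ∈ Q ∧
      (∃ a ∈ A, G.Joined Q a s) ∧ ∀ u ∈ Q, u ≠ s → ∃ a ∈ A, G.Joined (Q \ {s}) a u := by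
    intro s
    by_cases hs : s ∈ T
    · obtain ⟨i, hi⟩ := tsurj ⟨s, hs⟩
      have hi : t i = s := congrArg Subtype.val hi
      obtain ⟨Q, hQ, -, hbQ, hjQ, hQ'⟩ := (hj i).exists_path
      refine ⟨Q, fun _ => ⟨i, hi, hQ, hi ▸ hbQ, ⟨a i, ha i, hi ▸ hjQ⟩, ?_⟩⟩
      intro u hu hus
      exact ⟨a i, ha i, hi ▸ hQ' u hu (hi ▸ hus)⟩
    · exact ⟨∅, fun h => absurd h hs⟩
  choose Q hQ using hex
  refine ⟨Q, fun s hs r hr hsr => ?_, fun s hs => ?_⟩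
  · obtain ⟨i, hi, hQi, -⟩ := hQ s hs
    obtain ⟨j, hj, hQj, -⟩ := hQ r hr
    have hij : i ≠ j := by
      rintro rfl
      exact hsr (hi.symm.trans hj)
    exact (hP hij).mono hQi hQj
  · obtain ⟨i, -, -, h1, h2, h3⟩ := hQ s hs
    exact ⟨h1, h2, h3⟩

/-- The combination step in Göring's proof of Menger's theorem. -/
theorem exists_paths_of_insert [DecidableEq V] {A B : Set V} {X : Finset V} {x y : V}
    (hHG : H ≤ G) (hxy : G.Adj x y) (hx : x ∉ X) (hy : y ∉ X)
    (hsep : ∀ a ∈ A, ∀ b ∈ B, ¬ H.Joined (X : Set V)ᶜ a b)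
    (hA : ∃ P : Fin (insert x X).card → Set V, Pairwise (fun i j => Disjoint (P i) (P j)) ∧
      ∀ i, ∃ a ∈ A, ∃ t ∈ insert x X, H.Joined (P i) a t)
    (hB : ∃ P : Fin (insert y X).card → Set V, Pairwise (fun i j => Disjoint (P i) (P j)) ∧
      ∀ i, ∃ b ∈ B, ∃ t ∈ insert y X, H.Joined (P i) b t) :
    ∃ P : Fin (X.card + 1) → Set V, Pairwise (fun i j => Disjoint (P i) (P j)) ∧
      ∀ i, ∃ a ∈ A, ∃ b ∈ B, G.Joined (P i) a b := by
  obtain ⟨P, hPd, hP⟩ := exists_paths_of_card_eq hA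
  obtain ⟨Q, hQd, hQ⟩ := exists_paths_of_card_eq hB
  -- A piece `P s` meets `X` at most in its end `s`, so each of its vertices outside `X` is linked
  -- to its source set while avoiding `X`.
  have side : ∀ {C : Set V} {z : V} {P : V → Set V}, z ∉ X →
      (∀ s ∈ insert z X, ∀ t ∈ insert z X, s ≠ t → Disjoint (P s) (P t)) →
      (∀ t ∈ insert z X, t ∈ P t ∧ (∃ a ∈ C, H.Joined (P t) a t) ∧
        ∀ u ∈ P t, u ≠ t → ∃ a ∈ C, H.Joined (P t \ {t}) a u) →
      ∀ s ∈ insert z X, ∀ v ∈ P s, v ∉ X → ∃ a ∈ C, H.Joined (X : Set V)ᶜ a v := by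
    intro C z P hz hPd hP s hs v hv hvX
    have hmeet : ∀ u ∈ P s, u ∈ X → u = s := by
      intro u hu huX
      by_contra hne
      have huT : u ∈ insert z X := Finset.mem_insert_of_mem huX
      exact Set.disjoint_left.1 (hPd u huT s hs hne) (hP u huT).1 hu
    obtain ⟨-, ⟨a, ha, haj⟩, h3⟩ := hP s hs
    by_cases hvs : v = s
    · subst hvs
      exact ⟨a, ha, haj.mono fun u hu huX => hvX (hmeet u hu huX ▸ huX)⟩
    · obtain ⟨a, ha, haj⟩ := h3 v hv hvs
      exact ⟨a, ha, haj.mono fun u hu huX => hu.2 (hmeet u hu.1 huX)⟩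
  -- A vertex common to an `A`-piece and a `B`-piece lies in `X`, where it is the end of both;
  -- otherwise it would give an `A`-`B` walk in `H` avoiding `X`.
  have cross : ∀ s ∈ insert x X, ∀ t ∈ insert y X, s ≠ t ∨ s ∉ X → Disjoint (P s) (Q t) := by
    intro s hs t ht hst
    rw [Set.disjoint_left]
    intro v hvP hvQ
    by_cases hvX : v ∈ X
    · have h1 : s = v := by
        by_contra hne
        have hvT : v ∈ insert x X := Finset.mem_insert_of_mem hvX
        exact Set.disjoint_left.1 (hPd s hs v hvT hne) hvP (hP v hvT).1
      have h2 : t = v := by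
        by_contra hne
        have hvT : v ∈ insert y X := Finset.mem_insert_of_mem hvX
        exact Set.disjoint_left.1 (hQd t ht v hvT hne) hvQ (hQ v hvT).1
      rcases hst with hst | hst
      · exact hst (h1.trans h2.symm)
      · exact hst (h1 ▸ hvX)
    · obtain ⟨a, ha, haj⟩ := side hx hPd hP s hs v hvP hvX
      obtain ⟨b, hb, hbj⟩ := side hy hQd hQ t ht v hvQ hvX
      exact hsep a ha b hb (haj.trans hbj.symm)
  have hcard : (insert x X).card = X.card + 1 := Finset.card_insert_of_notMem hx
  let e : Fin (X.card + 1) ≃ (insert x X : Finset V) := (finCongr hcard.symm).trans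
    (insert x X).equivFin.symm
  -- Pieces with the same end in `X` are glued there; the piece ending in `x` is glued to the one
  -- ending in `y` by the edge `xy`.
  let τ : V → V := fun t => if t = x then y else t
  have hτ : ∀ s ∈ insert x X, τ s ∈ insert y X := by
    intro s hs
    by_cases h : s = x
    · simp [τ, h]
    · simpa [τ, h] using Or.inr ((Finset.mem_insert.1 hs).resolve_left h)
  have hτne : ∀ s ∈ insert x X, ∀ t ∈ insert x X, s ≠ t → τ s ≠ τ t ∧ (s ≠ τ t ∨ s ∉ X) := by
    intro s hs t ht hst
    rw [Finset.mem_insert] at hs ht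
    by_cases h : s = x <;> by_cases h' : t = x <;> simp only [τ, h, h', if_true, if_false] <;> grind
  refine ⟨fun i => P (e i) ∪ Q (τ (e i)), fun i j hij => ?_, fun i => ?_⟩
  · have hne : (e i : V) ≠ e j := fun h => hij (e.injective (Subtype.ext h))
    have hi := (e i).2
    have hj := (e j).2
    simp only [Set.disjoint_union_left, Set.disjoint_union_right]
    exact ⟨⟨hPd _ hi _ hj hne, (cross _ hj _ (hτ _ hi) (hτne _ hj _ hi hne.symm).2).symm⟩,
      cross _ hi _ (hτ _ hj) (hτne _ hi _ hj hne).2,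
      hQd _ (hτ _ hi) _ (hτ _ hj) (hτne _ hi _ hj hne).1⟩
  · have hi := (e i).2
    obtain ⟨-, ⟨a, ha, haj⟩, -⟩ := hP _ hi
    obtain ⟨-, ⟨b, hb, hbj⟩, -⟩ := hQ _ (hτ _ hi)
    refine ⟨a, ha, b, hb, ((haj.mono_graph hHG).mono subset_union_left).trans
      (Joined.trans ?_ ((hbj.symm.mono_graph hHG).mono subset_union_right))⟩
    by_cases h : (e i : V) = x
    · have hτx : τ (e i) = y := by simp [τ, h]
      rw [hτx] at hbj ⊢
      rw [h] at haj ⊢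
      exact Joined.of_adj hxy (Or.inl haj.mem_right) (Or.inr hbj.mem_right)
    · have hτx : τ (e i) = e i := by simp [τ, h]
      rw [hτx]
      exact Joined.refl (Or.inl haj.mem_right)

/-- **Menger's theorem**: if no set of fewer than `k` vertices separates `A` from `B`, then there
are `k` pairwise disjoint paths from `A` to `B`. -/
theorem exists_disjoint_joined [Finite V] (G : SimpleGraph V) (A B : Set V) (k : ℕ)
    (h : ∀ X : Finset V, X.card < k → ∃ a ∈ A, ∃ b ∈ B, G.Joined (X : Set V)ᶜ a b) :
    ∃ P : Fin k → Set V, Pairwise (fun i j => Disjoint (P i) (P j)) ∧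
      ∀ i, ∃ a ∈ A, ∃ b ∈ B, G.Joined (P i) a b := by
  classical
  have := Fintype.ofFinite V
  induction hm : G.edgeSet.ncard using Nat.strong_induction_on generalizing G A B k with
  | _ m ih =>
  by_cases hE : ∃ x y, G.Adj x y
  · obtain ⟨x, y, hxy⟩ := hE
    set H := G.deleteEdges {s(x, y)} with hH
    have hHG : H ≤ G := G.deleteEdges_le _
    have hlt : H.edgeSet.ncard < m := by
      rw [← hm]
      refine Set.ncard_lt_ncard ⟨edgeSet_mono hHG, fun hsub => ?_⟩ (Set.toFinite _)
      have : s(x, y) ∈ H.edgeSet := hsub hxy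
      simp [hH] at this
    have hG : ∀ u w, G.Adj u w → H.Adj u w ∨ (u = x ∧ w = y) ∨ (u = y ∧ w = x) := by
      intro u w huw
      by_cases he : s(u, w) = s(x, y)
      · right
        simpa using he
      · left
        simp only [hH, deleteEdges_adj, mem_singleton_iff]
        exact ⟨huw, he⟩
    by_cases hHk : ∀ X : Finset V, X.card < k → ∃ a ∈ A, ∃ b ∈ B, H.Joined (X : Set V)ᶜ a b
    · obtain ⟨P, hP, hj⟩ := ih _ hlt H A B k hHk rfl
      refine ⟨P, hP, fun i => ?_⟩
      obtain ⟨a, ha, b, hb, hab⟩ := hj i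
      exact ⟨a, ha, b, hb, hab.mono_graph hHG⟩
    push Not at hHk
    obtain ⟨X, hXk, hsep⟩ := hHk
    -- Adding either end of the edge `xy` to `X` gives a separator of `G`, which has at least `k`
    -- elements. Hence `X` has exactly `k - 1`.
    have big : ∀ z, (z = x ∨ z = y) → z ∉ X ∧ (insert z X).card = k := by
      intro z hz
      have hk : ¬ (insert z X).card < k := by
        intro hlt
        obtain ⟨a, ha, b, hb, hab⟩ := h _ hlt
        have haz := hab.mem_left
        have hR := hab.mem_of_closed (R := {u | u ≠ z ∧ H.Joined (X : Set V)ᶜ a u})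
          ⟨fun h => haz (by simp [h]), Joined.refl (fun h => haz (by simp [Finset.mem_coe.1 h]))⟩
          (by
            rintro u ⟨huz, hu⟩ w hw huw
            have hwz : w ≠ z := fun h => hw (by simp [h])
            have hwX : w ∈ (X : Set V)ᶜ := fun h => hw (by simp [Finset.mem_coe.1 h])
            refine ⟨hwz, Joined.tail hu ?_ hwX⟩
            rcases hG u w huw with h | ⟨rfl, rfl⟩ | ⟨rfl, rfl⟩
            · exact h
            · rcases hz with rfl | rfl <;> contradiction
            · rcases hz with rfl | rfl <;> contradiction)
        exact hsep a ha b hb hR.2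
      have := Finset.card_insert_le z X
      refine ⟨fun hzX => ?_, by omega⟩
      rw [Finset.insert_eq_of_mem hzX] at hk
      exact hk hXk
    obtain ⟨hxX, hxk⟩ := big x (Or.inl rfl)
    obtain ⟨hyX, hyk⟩ := big y (Or.inr rfl)
    have hk1 : X.card + 1 = k := by rw [← hxk, Finset.card_insert_of_notMem hxX]
    -- Here the edge is oriented: in `H` without `X`, its end `y` is off the `A` side and `x` is off
    -- the `B` side.
    have main : ∀ x y, x ∉ X → y ∉ X → G.Adj x y →
        (∀ u w, G.Adj u w → H.Adj u w ∨ (u = x ∧ w = y) ∨ (u = y ∧ w = x)) →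
        (∀ a ∈ A, ¬ H.Joined (X : Set V)ᶜ a y) → (∀ b ∈ B, ¬ H.Joined (X : Set V)ᶜ b x) →
        ∃ P : Fin k → Set V, Pairwise (fun i j => Disjoint (P i) (P j)) ∧
          ∀ i, ∃ a ∈ A, ∃ b ∈ B, G.Joined (P i) a b := by
      intro x y hxX hyX hxy hG hAy hBx
      subst hk1
      refine exists_paths_of_insert hHG hxy hxX hyX hsep ?_ ?_
      · refine ih _ hlt H A (insert x X : Finset V) _ (fun Y hY => ?_) rfl
        rw [Finset.card_insert_of_notMem hxX] at hY
        rw [Finset.coe_insert]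
        exact exists_joined_insert hG hsep hAy (h Y hY)
      · refine ih _ hlt H B (insert y X : Finset V) _ (fun Y hY => ?_) rfl
        rw [Finset.card_insert_of_notMem hyX] at hY
        rw [Finset.coe_insert]
        obtain ⟨a, ha, b, hb, hab⟩ := h Y hY
        exact exists_joined_insert (fun u w huw => (hG u w huw).imp_right Or.symm)
          (fun b hb a ha hba => hsep a ha b hb hba.symm) hBx ⟨b, hb, a, ha, hab.symm⟩
    obtain ⟨a, ha, b, hb, hab⟩ := h X hXk
    -- A walk across `X` in `G` must use the deleted edge, so in `H` its start already reaches `x`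
    -- or `y`. Applied from both sides this fixes the orientation.
    have hit : ∀ {C D : Set V}, (∀ a ∈ C, ∀ b ∈ D, ¬ H.Joined (X : Set V)ᶜ a b) →
        ∀ a ∈ C, ∀ b ∈ D, G.Joined (X : Set V)ᶜ a b →
        (H.Joined (X : Set V)ᶜ a x) ∨ (H.Joined (X : Set V)ᶜ a y) := by
      intro C D hsep a ha b hb hab
      by_contra! hno
      refine hsep a ha b hb (hab.mem_of_closed (R := {u | H.Joined (X : Set V)ᶜ a u})
        (Joined.refl hab.mem_left) fun u hu w hw huw => ?_)
      rcases hG u w huw with h | ⟨rfl, rfl⟩ | ⟨rfl, rfl⟩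
      · exact Joined.tail hu h hw
      · exact absurd hu hno.1
      · exact absurd hu hno.2
    have hsep' : ∀ b ∈ B, ∀ a ∈ A, ¬ H.Joined (X : Set V)ᶜ b a :=
      fun b hb a ha hba => hsep a ha b hb hba.symm
    rcases hit hsep a ha b hb hab with hax | hay <;>
      rcases hit hsep' b hb a ha hab.symm with hbx | hby
    · exact absurd (hax.trans hbx.symm) (hsep a ha b hb)
    · exact main x y hxX hyX hxy hG
        (fun a' ha' hj => hsep a' ha' b hb (hj.trans hby.symm))
        (fun b' hb' hj => hsep a ha b' hb' (hax.trans hj.symm))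
    · exact main y x hyX hxX hxy.symm (fun u w huw => (hG u w huw).imp_right Or.symm)
        (fun a' ha' hj => hsep a' ha' b hb (hj.trans hbx.symm))
        (fun b' hb' hj => hsep a ha b' hb' (hay.trans hj.symm))
    · exact absurd (hay.trans hby.symm) (hsep a ha b hb)
  · push Not at hE
    have heq : ∀ {U : Set V} {a b : V}, G.Joined U a b → a = b := by
      intro U a b hab
      cases hab with
      | refl _ => rfl
      | tail _ hbc _ => exact absurd hbc (hE _ _)
    -- Without edges all walks are trivial, so `A ∩ B` itself separates.
    have hcard : k ≤ (A ∩ B).toFinset.card := by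
      by_contra! hlt
      obtain ⟨a, ha, b, hb, hab⟩ := h _ hlt
      have hmem := hab.mem_left
      obtain rfl := heq hab
      exact hmem (by simp [ha, hb])
    obtain ⟨T, hT, hTk⟩ := Finset.exists_subset_card_eq hcard
    let e : Fin k ≃ T := (finCongr hTk.symm).trans T.equivFin.symm
    refine ⟨fun i => {(e i : V)}, fun i j hij => ?_, fun i => ?_⟩
    · exact Set.disjoint_singleton.2 fun h => hij (e.injective (Subtype.ext h))
    · have := hT (e i).2
      rw [Set.mem_toFinset] at this
      exact ⟨e i, this.1, e i, this.2, Joined.refl rfl⟩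

/-! ### Connected sets, fans and linkages. -/

theorem Joined.exists_adj (h : G.Joined U a b) (hab : a ≠ b) :
    ∃ u, G.Adj a u ∧ G.Joined (U \ {a}) u b := by
  have key : ∀ c, G.Joined U a c → c = a ∨ ∃ u, G.Adj a u ∧ G.Joined (U \ {a}) u c := by
    intro c hc
    induction hc with
    | refl _ => exact Or.inl rfl
    | @tail b c _ hbc hc ih =>
      by_cases hca : c = a
      · exact Or.inl hca
      rcases ih with rfl | ⟨u, hu, huc⟩
      · exact Or.inr ⟨c, hbc, Joined.refl ⟨hc, hca⟩⟩
      · exact Or.inr ⟨u, hu, Joined.tail huc hbc ⟨hc, hca⟩⟩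
  exact (key b h).resolve_left (Ne.symm hab)

/-- `U` is nonempty and induces a connected subgraph of `G`. -/
def ConnSet (G : SimpleGraph V) (U : Set V) : Prop :=
  ∃ u ∈ U, ∀ v ∈ U, G.Joined U u v

/-- No set of fewer than `d` vertices separates two vertices of `C` inside `C`. -/
def ConnIn (G : SimpleGraph V) (C : Set V) (d : ℕ) : Prop :=
  ∀ X : Finset V, X.card < d → ∀ u ∈ C, ∀ v ∈ C, u ∉ X → v ∉ X → G.Joined (C \ X) u v

namespace ConnSet

theorem joined (h : G.ConnSet U) (ha : a ∈ U) (hb : b ∈ U) : G.Joined U a b := by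
  obtain ⟨u, -, hu⟩ := h
  exact (hu a ha).symm.trans (hu b hb)

theorem singleton (a : V) : G.ConnSet {a} :=
  ⟨a, rfl, fun v hv => by rw [mem_singleton_iff.1 hv]; exact Joined.refl rfl⟩

theorem union_of_adj (hU : G.ConnSet U) (hW : G.ConnSet W) (ha : a ∈ U) (hb : b ∈ W)
    (hab : G.Adj a b) : G.ConnSet (U ∪ W) := by
  refine ⟨a, Or.inl ha, ?_⟩
  rintro v (hv | hv)
  · exact (hU.joined ha hv).mono subset_union_left
  · exact (Joined.of_adj hab (Or.inl ha) (Or.inr hb)).trans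
      ((hW.joined hb hv).mono subset_union_right)

theorem union_of_mem (hU : G.ConnSet U) (hW : G.ConnSet W) (ha : a ∈ U) (hb : a ∈ W) :
    G.ConnSet (U ∪ W) := by
  refine ⟨a, Or.inl ha, ?_⟩
  rintro v (hv | hv)
  · exact (hU.joined ha hv).mono subset_union_left
  · exact (hW.joined hb hv).mono subset_union_right

end ConnSet

theorem Joined.exists_connSet (h : G.Joined U a b) : ∃ P ⊆ U, a ∈ P ∧ b ∈ P ∧ G.ConnSet P :=
  ⟨{u | G.Joined U a u}, fun _ hu => Joined.mem_right hu, Joined.refl h.mem_left, h,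
    a, Joined.refl h.mem_left, fun _ hu => Joined.restrict hu⟩

/-- Menger's theorem inside a set `C` of vertices, with connected sets in the place of paths. -/
theorem exists_disjoint_connSet [Finite V] (G : SimpleGraph V) {A B C : Set V} {k : ℕ}
    (h : ∀ X : Finset V, X.card < k → ∃ a ∈ A, ∃ b ∈ B, G.Joined (C \ X) a b) :
    ∃ P : Fin k → Set V, Pairwise (fun i j => Disjoint (P i) (P j)) ∧
      ∀ i, P i ⊆ C ∧ G.ConnSet (P i) ∧ (∃ a ∈ A, a ∈ P i) ∧ ∃ b ∈ B, b ∈ P i := by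
  let H : SimpleGraph V :=
    { Adj := fun u w => G.Adj u w ∧ u ∈ C ∧ w ∈ C
      symm := ⟨fun u w h => ⟨h.1.symm, h.2.2, h.2.1⟩⟩
      loopless := ⟨fun u h => G.loopless.irrefl u h.1⟩ }
  -- Trivial walks use no edge of `H`, so only starting in `A ∩ C` keeps them inside `C`.
  obtain ⟨P, hP, hj⟩ := H.exists_disjoint_joined (A ∩ C) B k (by
    intro X hX
    obtain ⟨a, ha, b, hb, hab⟩ := h X hX
    refine ⟨a, ⟨ha, hab.mem_left.1⟩, b, hb, ?_⟩
    clear hb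
    induction hab with
    | refl h => exact Joined.refl h.2
    | tail h hbc hc ih => exact Joined.tail ih ⟨hbc, h.mem_right.1, hc.1⟩ hc.2)
  have hQ : ∀ i, ∃ Q ⊆ P i, Q ⊆ C ∧ G.ConnSet Q ∧ (∃ a ∈ A, a ∈ Q) ∧ ∃ b ∈ B, b ∈ Q := by
    intro i
    obtain ⟨a, ha, b, hb, hab⟩ := hj i
    have hG : G.Joined (P i ∩ C) a b := by
      clear hb
      induction hab with
      | refl h => exact Joined.refl ⟨h, ha.2⟩
      | tail h hbc hc ih => exact Joined.tail ih hbc.1 ⟨hc, hbc.2.2⟩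
    obtain ⟨Q, hQ, haQ, hbQ, hQc⟩ := hG.exists_connSet
    exact ⟨Q, hQ.trans inter_subset_left, hQ.trans inter_subset_right, hQc, ⟨a, ha.1, haQ⟩,
      b, hb, hbQ⟩
  choose Q hQP hQ using hQ
  exact ⟨Q, fun i j hij => (hP hij).mono (hQP i) (hQP j), hQ⟩

/-- `F` is the rest of a path from `x` to `a` after removal of `x`. -/
def Leg (G : SimpleGraph V) (x a : V) (F : Set V) : Prop :=
  (a = x ∧ F = ∅) ∨ (a ∈ F ∧ G.ConnSet F ∧ ∃ u ∈ F, G.Adj x u)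

namespace Leg

variable {x : V} {F M : Set V}

/-- A core `M` absorbs the leg and becomes adjacent to `x` without containing it by way of the leg.
In the degenerate case `a = x` the leg is empty and `m` is the neighbour. -/
theorem connSet_union (h : G.Leg x a F) (hM : G.ConnSet M) {m : V} (hm : m ∈ M)
    (hma : G.Adj m a) : G.ConnSet (M ∪ F) ∧ ∃ u ∈ M ∪ F, G.Adj x u := by
  rcases h with ⟨rfl, rfl⟩ | ⟨ha, hF, u, hu, hxu⟩
  · rw [union_empty]
    exact ⟨hM, m, hm, hma.symm⟩
  · exact ⟨hM.union_of_adj hF hm ha hma, u, Or.inr hu, hxu⟩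

theorem connSet_insert (h : G.Leg x a F) : G.ConnSet ({x} ∪ F) := by
  rcases h with ⟨rfl, rfl⟩ | ⟨ha, hF, u, hu, hxu⟩
  · rw [union_empty]
    exact ConnSet.singleton _
  · exact (ConnSet.singleton x).union_of_adj hF rfl hu hxu

theorem mem_insert (h : G.Leg x a F) : a ∈ {x} ∪ F := by
  rcases h with ⟨rfl, rfl⟩ | ⟨ha, -⟩
  · exact Or.inl rfl
  · exact Or.inr ha

end Leg

/-- The fan lemma: a vertex `x` can be joined to the vertices `g m`, `m ∈ K`, by paths that have
only `x` in common. -/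
theorem ConnIn.exists_fan [Finite V] [DecidableEq V] {ι : Type*} {C : Set V} {d : ℕ}
    (h : G.ConnIn C d) {x : V} (hx : x ∈ C) (K : Finset ι) (g : ι → V) (hg : Set.InjOn g K)
    (hgC : ∀ m ∈ K, g m ∈ C) (hK : ((K.image g).erase x).card ≤ d) :
    ∃ F : ι → Set V, (∀ m ∈ K, ∀ l ∈ K, m ≠ l → Disjoint (F m) (F l)) ∧
      ∀ m ∈ K, F m ⊆ C \ {x} ∧ G.Leg x (g m) (F m) := by
  set T := (K.image g).erase x with hT
  obtain ⟨P, hP, hPC⟩ := G.exists_disjoint_connSet (A := {u | G.Adj x u}) (B := T)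
    (C := C \ {x}) (k := T.card) (by
      intro X hX
      obtain ⟨t, ht, htX⟩ := Finset.exists_mem_notMem_of_card_lt_card hX
      have htx : t ≠ x := (Finset.mem_erase.1 ht).1
      obtain ⟨m, hm, rfl⟩ := Finset.mem_image.1 (Finset.mem_erase.1 ht).2
      -- `x` may belong to `X`, but `ConnIn` speaks only of vertices outside the deleted set; the
      -- walk is instead cut at its last visit to `x`.
      obtain ⟨u, hu, huj⟩ := (h (X.erase x) ((Finset.card_erase_le.trans_lt hX).trans_le hK) x hx
        (g m) (hgC m hm) (by simp) (by simp [htX])).exists_adj htx.symm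
      refine ⟨u, hu, g m, ht, huj.mono ?_⟩
      rintro w ⟨⟨hwC, hwX⟩, hwx⟩
      exact ⟨⟨hwC, hwx⟩, fun hw => hwX (Finset.mem_erase.2 ⟨hwx, hw⟩)⟩)
  choose hPC hPconn hPx t ht htP using hPC
  have tinj : Function.Injective (fun i => (⟨t i, ht i⟩ : T)) := by
    intro i j hij
    by_contra hne
    have : t i = t j := congrArg Subtype.val hij
    exact Set.disjoint_left.1 (hP hne) (htP i) (this ▸ htP j)
  have tsurj := ((Fintype.bijective_iff_injective_and_card _).2 ⟨tinj, by simp⟩).2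
  have hex : ∀ m, ∃ F : Set V, m ∈ K →
      (g m = x ∧ F = ∅) ∨ (∃ i, t i = g m ∧ F = P i) := by
    intro m
    by_cases hm : m ∈ K
    · by_cases hmx : g m = x
      · exact ⟨∅, fun _ => Or.inl ⟨hmx, rfl⟩⟩
      · obtain ⟨i, hi⟩ := tsurj ⟨g m, by simp [hT, hmx]; exact ⟨m, hm, rfl⟩⟩
        exact ⟨P i, fun _ => Or.inr ⟨i, congrArg Subtype.val hi, rfl⟩⟩
    · exact ⟨∅, fun h => absurd h hm⟩
  choose F hF using hex
  refine ⟨F, fun m hm l hl hml => ?_, fun m hm => ?_⟩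
  · rcases hF m hm with ⟨-, h1⟩ | ⟨i, hi, h1⟩
    · simp [h1]
    rcases hF l hl with ⟨-, h2⟩ | ⟨j, hj, h2⟩
    · simp [h2]
    rw [h1, h2]
    refine hP fun hij => hml (hg hm hl ?_)
    rw [← hi, ← hj, hij]
  · rcases hF m hm with ⟨h0, h1⟩ | ⟨i, hi, h1⟩
    · rw [h1]
      exact ⟨empty_subset _, Or.inl ⟨h0, rfl⟩⟩
    · rw [h1]
      obtain ⟨u, hu, huP⟩ := hPx i
      exact ⟨hPC i, Or.inr ⟨hi ▸ htP i, hPconn i, u, huP, hu⟩⟩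

/-- Internally disjoint paths between two vertices `x` and `y`, given by their inner parts. -/
theorem ConnIn.exists_links [Finite V] {C : Set V} {d k : ℕ} (h : G.ConnIn C d) {x y : V}
    (hx : x ∈ C) (hy : y ∈ C) (hxy : x ≠ y)
    (hk : (k ≤ d ∧ ¬ G.Adj x y) ∨ (k < d ∧ d < C.ncard)) :
    ∃ M : Fin k → Set V, Pairwise (fun i j => Disjoint (M i) (M j)) ∧
      ∀ i, M i ⊆ C \ {x, y} ∧ G.ConnSet (M i) ∧ (∃ u ∈ M i, G.Adj x u) ∧
        ∃ u ∈ M i, G.Adj y u := by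
  classical
  obtain ⟨P, hP, hPC⟩ := G.exists_disjoint_connSet (A := {u | G.Adj x u}) (B := {u | G.Adj y u})
    (C := C \ {x, y}) (k := k) (by
      intro X hX
      set X' := (X.erase x).erase y with hX'
      have hX'c : X'.card < k := (Finset.card_erase_le.trans Finset.card_erase_le).trans_lt hX
      have hsub : ∀ w ∈ C, w ∉ X' → w ≠ x → w ≠ y → w ∈ (C \ {x, y}) \ (X : Set V) := by
        intro w hw hwX hwx hwy
        refine ⟨⟨hw, by simp [hwx, hwy]⟩, fun h => hwX ?_⟩
        simpa [hX', hwx, hwy] using h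
      rcases hk with ⟨hkd, hadj⟩ | ⟨hkd, hdC⟩
      · obtain ⟨a, ha, haj⟩ := (h X' (hX'c.trans_le hkd) x hx y hy (by simp [hX'])
          (by simp [hX'])).exists_adj hxy
        have hay : y ≠ a := by
          rintro rfl
          exact hadj ha
        obtain ⟨b, hb, hbj⟩ := haj.symm.exists_adj hay
        refine ⟨a, ha, b, hb, hbj.symm.mono ?_⟩
        rintro w ⟨⟨⟨hwC, hwX⟩, hwx⟩, hwy⟩
        exact hsub w hwC hwX hwx hwy
      · have hc1 : (insert x X').card < d := by
          have := Finset.card_insert_le x X'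
          omega
        have hc2 : (insert y X').card < d := by
          have := Finset.card_insert_le y X'
          omega
        -- When `x` and `y` are adjacent, the edge `xy` has to be avoided. A detour point `w` yields
        -- a neighbour `b ≠ x` of `y`, reached with `x` deleted; then `b` is linked to `x` with `y`
        -- deleted. Each deletion costs one, hence `k < d`.
        obtain ⟨w, hw, hwX⟩ : ∃ w ∈ C, w ∉ insert y (insert x X') := by
          by_contra! hno
          have h1 : C.ncard ≤ (insert y (insert x X')).card := by
            rw [← Set.ncard_coe_finset]
            exact Set.ncard_le_ncard hno (Finset.finite_toSet _)
          have := Finset.card_insert_le y (insert x X')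
          omega
        have hwy : w ≠ y := by
          rintro rfl
          simp at hwX
        obtain ⟨b, hb, hbj⟩ := (h _ hc1 y hy w hw (by simp [hX', hxy.symm])
          (fun h => hwX (Finset.mem_insert_of_mem h))).exists_adj hwy.symm
        obtain ⟨⟨hbC, hbX⟩, hby⟩ := hbj.mem_left
        have hbx : b ≠ x := by
          rintro rfl
          simp at hbX
        have hbX' : b ∉ X' := fun h => hbX (by simp [h])
        obtain ⟨a, ha, haj⟩ := (h _ hc2 x hx b hbC (by simp [hX', hxy])
          (by simpa [hbX'] using hby)).exists_adj hbx.symm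
        refine ⟨a, ha, b, hb, haj.mono ?_⟩
        rintro w ⟨⟨hwC, hwX⟩, hwx⟩
        exact hsub w hwC (fun h => hwX (by simp [h])) hwx (fun h => hwX (by simp [h])))
  exact ⟨P, hP, fun i => ⟨(hPC i).1, (hPC i).2.1, (hPC i).2.2.1.imp fun u hu => hu.symm,
    (hPC i).2.2.2.imp fun u hu => hu.symm⟩⟩

/-! ### Families of connected subgraphs sharing only `S`. -/

/-- Connected subgraphs containing `S` that pairwise have no other common vertices, and no common
edges. -/
def IsConnectedFamily (G : SimpleGraph V) (S : Set V) {ι : Type*} (T : ι → G.Subgraph) : Prop :=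
  (∀ i, (T i).Connected ∧ S ⊆ (T i).verts) ∧
  ∀ i j, i ≠ j → (T i).verts ∩ (T j).verts ⊆ S ∧ ∀ u v, (T i).Adj u v → ¬ (T j).Adj u v

theorem Joined.coe_reachable {H : G.Subgraph} (hU : U ⊆ H.verts)
    (hH : ∀ u ∈ U, ∀ w ∈ U, G.Adj u w → H.Adj u w) (h : G.Joined U a b) :
    H.coe.Reachable ⟨a, hU h.mem_left⟩ ⟨b, hU h.mem_right⟩ := by
  have ha := h.mem_left
  induction h with
  | refl _ => exact Reachable.refl _
  | tail h hbc hc ih =>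
    refine ih.trans (Adj.reachable ?_)
    exact hH _ h.mem_right _ hc hbc

theorem ConnSet.induce_connected (h : G.ConnSet U) : ((⊤ : G.Subgraph).induce U).Connected := by
  obtain ⟨u, hu, -⟩ := id h
  refine ⟨{ preconnected := ?_, nonempty := ⟨⟨u, hu⟩⟩ }⟩
  rintro ⟨a, ha⟩ ⟨b, hb⟩
  exact (h.joined ha hb).coe_reachable (H := (⊤ : G.Subgraph).induce U) subset_rfl
    (fun u hu w hw huw => ⟨hu, hw, huw⟩)

/-- The subgraph on `U ∪ S` formed by all edges with an end in `U`. -/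
def starSubgraph (G : SimpleGraph V) (S U : Set V) : G.Subgraph where
  verts := U ∪ S
  Adj u w := G.Adj u w ∧ u ∈ U ∪ S ∧ w ∈ U ∪ S ∧ (u ∈ U ∨ w ∈ U)
  adj_sub h := h.1
  edge_vert h := h.2.1
  symm := ⟨fun _ _ h => ⟨h.1.symm, h.2.2.1, h.2.1, h.2.2.2.symm⟩⟩

theorem ConnSet.starSubgraph_connected (h : G.ConnSet U) {S : Set V}
    (hS : ∀ s ∈ S, ∃ u ∈ U, G.Adj s u) : (G.starSubgraph S U).Connected := by
  obtain ⟨u₀, hu₀, -⟩ := id h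
  have hsub : U ⊆ (G.starSubgraph S U).verts := subset_union_left
  have key : ∀ v : (G.starSubgraph S U).verts, (G.starSubgraph S U).coe.Reachable v
      ⟨u₀, hsub hu₀⟩ := by
    rintro ⟨v, hv⟩
    have inU : ∀ v (hv : v ∈ U), (G.starSubgraph S U).coe.Reachable ⟨v, hsub hv⟩
        ⟨u₀, hsub hu₀⟩ := fun v hv => (h.joined hv hu₀).coe_reachable hsub
          (fun u hu w hw huw => ⟨huw, Or.inl hu, Or.inl hw, Or.inl hu⟩)
    rcases id hv with hvU | hvS
    · exact inU v hvU
    · obtain ⟨u, hu, hvu⟩ := hS v hvS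
      refine Reachable.trans (Adj.reachable ?_) (inU u hu)
      exact ⟨hvu, Or.inr hvS, Or.inl hu, Or.inr hu⟩
  exact ⟨{ preconnected := fun a b => (key a).trans (key b).symm, nonempty := ⟨⟨u₀, hsub hu₀⟩⟩ }⟩

/-- A family of connected subgraphs is extended by the stars over disjoint connected sets. -/
theorem IsConnectedFamily.extend {ι κ : Type*} {S : Set V} {T : κ → G.Subgraph}
    (hT : G.IsConnectedFamily S T) {U : ι → Set V}
    (hU : Pairwise (fun i j => Disjoint (U i) (U j))) (hUS : ∀ i, Disjoint (U i) S)
    (hUT : ∀ i j, Disjoint (U i) (T j).verts)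
    (hconn : ∀ i, G.ConnSet (U i) ∧ ∀ s ∈ S, ∃ u ∈ U i, G.Adj s u) :
    G.IsConnectedFamily S (Sum.elim (fun i => G.starSubgraph S (U i)) T) := by
  have hST : ∀ i v, v ∈ U i → v ∉ S := fun i _ h => Set.disjoint_left.1 (hUS i) h
  have hTT : ∀ i j v, v ∈ U i → v ∉ (T j).verts := fun i j _ h => Set.disjoint_left.1 (hUT i j) h
  refine ⟨?_, ?_⟩
  · rintro (i | i)
    · exact ⟨(hconn i).1.starSubgraph_connected (hconn i).2, subset_union_right⟩
    · exact hT.1 i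
  · rintro (i | i) (j | j) hij
    · have hne : i ≠ j := fun h => hij (h ▸ rfl)
      have hd : ∀ v, v ∈ U i → v ∉ U j := fun _ h => Set.disjoint_left.1 (hU hne) h
      refine ⟨?_, ?_⟩
      · rintro v ⟨hv | hv, hv' | hv'⟩
        · exact absurd hv' (hd v hv)
        all_goals assumption
      · rintro u v ⟨-, -, -, hu | hv⟩ ⟨-, hu', hv', -⟩
        · exact hu'.elim (hd u hu) (hST i u hu)
        · exact hv'.elim (hd v hv) (hST i v hv)
    · refine ⟨?_, ?_⟩
      · rintro v ⟨hv | hv, hv'⟩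
        · exact absurd hv' (hTT i j v hv)
        · exact hv
      · rintro u v ⟨-, -, -, hu | hv⟩ huv
        · exact hTT i j u hu huv.fst_mem
        · exact hTT i j v hv huv.snd_mem
    · refine ⟨?_, ?_⟩
      · rintro v ⟨hv', hv | hv⟩
        · exact absurd hv' (hTT j i v hv)
        · exact hv
      · rintro u v huv ⟨-, -, -, hu | hv⟩
        · exact hTT j i u hu huv.fst_mem
        · exact hTT j i v hv huv.snd_mem
    · exact hT.2 i j fun h => hij (h ▸ rfl)

theorem ConnSet.isConnectedFamily_induce {S : Set V} (h : G.ConnSet W) (hS : S ⊆ W) :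
    G.IsConnectedFamily S (fun _ : Unit => (⊤ : G.Subgraph).induce W) :=
  ⟨fun _ => ⟨h.induce_connected, hS⟩, fun i j hij => absurd (Subsingleton.elim i j) hij⟩

/-- A starting point for `IsConnectedFamily.extend` when all members are stars. -/
theorem IsConnectedFamily.of_isEmpty {ι : Type*} [IsEmpty ι] (S : Set V) (T : ι → G.Subgraph) :
    G.IsConnectedFamily S T :=
  ⟨fun i => isEmptyElim i, fun i => isEmptyElim i⟩

/-- There are `r` connected subgraphs inside `C` that pairwise meet in the vertices of `S` only. -/
def HasFamily (G : SimpleGraph V) (C S : Set V) (r : ℕ) : Prop :=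
  ∃ T : Fin r → G.Subgraph, G.IsConnectedFamily S T ∧ ∀ i, (T i).verts ⊆ C

theorem IsConnectedFamily.hasFamily {ι : Type*} [Fintype ι] {S : Set V} {T : ι → G.Subgraph}
    (h : G.IsConnectedFamily S T) {r : ℕ} (hr : Fintype.card ι = r) : G.HasFamily univ S r := by
  let e := (Fintype.equivFinOfCardEq hr).symm
  exact ⟨fun i => T (e i), ⟨fun i => h.1 _, fun i j hij => h.2 _ _ fun he => hij (e.injective he)⟩,
    fun i => subset_univ _⟩

end SimpleGraph

/-! ### Graphs composed of highly connected cells. -/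

namespace SimpleGraph

variable {V I : Type*} {G : SimpleGraph V} {c : V → I} {ext : V → V} {d : ℕ}

/-- The vertices of `G` are partitioned into the `d`-connected cells `c ⁻¹' {i}`, every vertex `v`
has a partner `ext v` in another cell, and any two cells are connected by such an edge. -/
structure IsCellular (G : SimpleGraph V) (c : V → I) (ext : V → V) (d : ℕ) : Prop where
  ext_ext : ∀ v, ext (ext v) = v
  adj_ext : ∀ v, G.Adj v (ext v)
  cell_ext : ∀ v, c (ext v) ≠ c v
  gate : ∀ i j, i ≠ j → ∃ v, c v = i ∧ c (ext v) = j
  conn : ∀ i, G.ConnIn {v | c v = i} d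

namespace IsCellular

theorem ext_injective (h : G.IsCellular c ext d) : Function.Injective ext :=
  Function.LeftInverse.injective h.ext_ext

variable [DecidableEq I]

/-- A union of cells stays connected when few vertices are removed. -/
theorem joined_of_card (h : G.IsCellular c ext d) {J : Finset I} {X : Finset V}
    (hX : X.card + 1 < J.card) (hcell : ∀ i ∈ J, (X.filter (fun v => c v = i)).card < d)
    {u v : V} (hu : c u ∈ J) (hv : c v ∈ J) (huX : u ∉ X) (hvX : v ∉ X) :
    G.Joined ({w | c w ∈ J} \ X) u v := by
  have inner : ∀ u v, c u ∈ J → c u = c v → u ∉ X → v ∉ X →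
      G.Joined ({w | c w ∈ J} \ X) u v := by
    intro u v hu huv huX hvX
    refine (h.conn (c u) _ (hcell _ hu) u rfl v huv.symm (by simp [huX]) (by simp [hvX])).mono ?_
    rintro w ⟨hw, hwX⟩
    rw [Set.mem_ofPred_eq] at hw
    refine ⟨by simpa [hw] using hu, fun hwX' => hwX ?_⟩
    simpa [hw] using hwX'
  have across : ∀ a b g, c a ∈ J → c b ∈ J → a ∉ X → b ∉ X → c g = c a → c (ext g) = c b →
      g ∉ X → ext g ∉ X → G.Joined ({w | c w ∈ J} \ X) a b := by
    intro a b g ha hb haX hbX hga hgb hgX hgX'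
    refine (inner a g ha hga.symm haX hgX).trans (Joined.trans ?_
      (inner (ext g) b (hgb ▸ hb) hgb hgX' hbX))
    exact Joined.of_adj (h.adj_ext g) ⟨by simpa [hga] using ha, hgX⟩ ⟨by simpa [hgb] using hb, hgX'⟩
  by_cases huv : c u = c v
  · exact inner u v hu huv huX hvX
  -- Each cell `m` of `J` other than that of `u` offers a route from the cell of `u` to that of `v`,
  -- through `m` or directly if `m` is the cell of `v`. The map `r` sends a deleted vertex to the
  -- only route whose gates it can block; there are more routes than deleted vertices.
  let r : V → I := fun w => if c w = c u then c (ext w) else if c (ext w) = c u then c w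
    else if c w = c v then c (ext w) else c w
  have hlt : (X.image r).card < (J.erase (c u)).card := by
    rw [Finset.card_erase_of_mem hu]
    have : (X.image r).card ≤ X.card := Finset.card_image_le
    omega
  obtain ⟨m, hm, hmX⟩ := Finset.exists_mem_notMem_of_card_lt_card hlt
  obtain ⟨hmu, hmJ⟩ := Finset.mem_erase.1 hm
  have free : ∀ w, r w = m → w ∉ X := fun w hw hwX => hmX (hw ▸ Finset.mem_image_of_mem r hwX)
  obtain ⟨g, hg, hg'⟩ := h.gate (c u) m (Ne.symm hmu)
  have hgX : g ∉ X := free g (by simp [r, hg, hg'])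
  have hgX' : ext g ∉ X := free (ext g) (by simp [r, hg, hg', h.ext_ext, hmu])
  by_cases hmv : m = c v
  · exact across u v g hu hv huX hvX hg (hg'.trans hmv) hgX hgX'
  obtain ⟨g', hg1, hg2⟩ := h.gate m (c v) hmv
  have hgX1 : g' ∉ X := free g' (by simp [r, hg1, hg2, hmu, hmv, Ne.symm huv])
  have hgX2 : ext g' ∉ X := free (ext g') (by simp [r, hg1, hg2, h.ext_ext, hmu, Ne.symm huv])
  exact (across u (ext g) g hu (by simpa [hg'] using hmJ) huX hgX' hg rfl hgX hgX').trans
    (across (ext g) v g' (by simpa [hg'] using hmJ) hv hgX' hvX (hg1.trans hg'.symm) hg2 hgX1 hgX2)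

/-- A choice of exits from the cell of `p`, one to each other cell, with one of them prescribed. -/
theorem exists_gates (h : G.IsCellular c ext d) (q : V) :
    ∃ g : I → V, (∀ m, m ≠ c q → c (g m) = c q ∧ c (ext (g m)) = m) ∧ g (c (ext q)) = q := by
  have : Nonempty V := ⟨q⟩
  choose! g hg using h.gate (c q)
  refine ⟨Function.update g (c (ext q)) q, fun m hm => ?_, by simp⟩
  by_cases hmq : m = c (ext q)
  · subst hmq
    simp
  · rw [Function.update_of_ne hmq]
    exact hg m hm.symm

/-- If `p` is itself one of the gates, its leg is empty, so `d`-connectivity serves `d + 1` targets.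
-/
theorem exists_gate_fan [Finite V] (h : G.IsCellular c ext d) {p : V} {g : I → V} {K : Finset I}
    (hg : ∀ m, m ≠ c p → c (g m) = c p ∧ c (ext (g m)) = m) (hpK : c p ∉ K)
    (hK : K.card ≤ d ∨ (K.card ≤ d + 1 ∧ p ∈ g '' K)) :
    ∃ F : I → Set V, (∀ m ∈ K, ∀ l ∈ K, ∀ v, v ∈ F m → v ∈ F l → m = l) ∧
      (∀ m ∈ K, ∀ v ∈ F m, c v = c p ∧ v ≠ p) ∧ ∀ m ∈ K, G.Leg p (g m) (F m) := by
  classical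
  have hne : ∀ m ∈ K, m ≠ c p := fun m hm hmp => hpK (hmp ▸ hm)
  obtain ⟨F, hFd, hF⟩ := (h.conn (c p)).exists_fan (x := p) rfl K g (by
      intro m hm l hl hml
      rw [← (hg m (hne m hm)).2, hml, (hg l (hne l hl)).2])
    (fun m hm => (hg m (hne m hm)).1) (by
      rcases hK with hK | ⟨hK, hp⟩
      · exact Finset.card_erase_le.trans (Finset.card_image_le.trans hK)
      · rw [Finset.card_erase_of_mem (by simpa using hp)]
        have : (K.image g).card ≤ K.card := Finset.card_image_le
        omega)
  refine ⟨F, fun m hm l hl v hv hv' => ?_, fun m hm v hv => (hF m hm).1 hv,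
    fun m hm => (hF m hm).2⟩
  by_contra hml
  exact Set.disjoint_left.1 (hFd m hm l hl hml) hv hv'

variable [Fintype I]

theorem connIn_compl (h : G.IsCellular c ext d) (hI : Fintype.card I = d + 2) (i : I) :
    G.ConnIn {v | c v ≠ i} d := by
  intro X hX u hu v hv huX hvX
  refine (h.joined_of_card (J := Finset.univ.erase i) (X := X) ?_
    (fun j _ => (Finset.card_filter_le _ _).trans_lt hX) (by simpa using hu) (by simpa using hv)
    huX hvX).mono ?_
  · rw [Finset.card_erase_of_mem (Finset.mem_univ _), Finset.card_univ]
    omega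
  · rintro w ⟨hw, hwX⟩
    exact ⟨by simpa using hw, hwX⟩

/-- Of at most `d` deleted vertices, either every cell contains fewer than `d` and `joined_of_card`
applies, or all lie in one cell. Then partners lead out of that cell into its untouched complement.
-/
theorem connIn_univ (h : G.IsCellular c ext d) (hI : Fintype.card I = d + 2) (hd : 0 < d) :
    G.ConnIn univ (d + 1) := by
  classical
  intro X hX u _ v _ huX hvX
  by_cases hcell : ∀ i, (X.filter (fun v => c v = i)).card < d
  · refine (h.joined_of_card (J := Finset.univ) (X := X) ?_ (fun i _ => hcell i)
      (Finset.mem_univ _) (Finset.mem_univ _) huX hvX).mono (sdiff_subset_sdiff_left (subset_univ _))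
    rw [Finset.card_univ]
    omega
  push Not at hcell
  obtain ⟨i, hi⟩ := hcell
  have hXi : ∀ w ∈ X, c w = i := by
    have := Finset.eq_of_subset_of_card_le (Finset.filter_subset (fun v => c v = i) X) (by omega)
    intro w hw
    rw [← this] at hw
    exact (Finset.mem_filter.1 hw).2
  have out : ∀ w, w ∉ X → ∃ w', c w' ≠ i ∧ G.Joined (univ \ X) w w' := by
    intro w hw
    by_cases hwi : c w = i
    · have hne : c (ext w) ≠ i := fun h' => h.cell_ext w (h'.trans hwi.symm)
      exact ⟨ext w, hne, Joined.of_adj (h.adj_ext w) ⟨trivial, hw⟩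
        ⟨trivial, fun hX => hne (hXi _ hX)⟩⟩
    · exact ⟨w, hwi, Joined.refl ⟨trivial, hw⟩⟩
  obtain ⟨u', hu', huj⟩ := out u huX
  obtain ⟨v', hv', hvj⟩ := out v hvX
  refine huj.trans (Joined.trans ?_ hvj.symm)
  refine (h.connIn_compl hI i ∅ (by simpa using hd) u' hu' v' hv' (by simp) (by simp)).mono ?_
  rintro w ⟨hw, -⟩
  exact ⟨trivial, fun hwX => hw (hXi w hwX)⟩

/-- A cell contains `d + 1` distinct gates, one for each other cell. -/
theorem lt_ncard_cell [Finite V] (h : G.IsCellular c ext d) (hI : Fintype.card I = d + 2) (i : I) :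
    d < {v | c v = i}.ncard := by
  obtain ⟨j, hj⟩ := Fintype.exists_ne_of_one_lt_card (by omega) i
  have : Nonempty V := ⟨(h.gate i j hj.symm).choose⟩
  choose! g hg using h.gate i
  have hinj : Set.InjOn g ((Finset.univ.erase i : Finset I) : Set I) := by
    intro m hm l hl hml
    have hm := (hg m (by simpa using Ne.symm (by simpa using hm))).2
    have hl := (hg l (by simpa using Ne.symm (by simpa using hl))).2
    rw [← hm, hml, hl]
  have h1 := Set.ncard_le_ncard (t := {v | c v = i})
    (s := g '' ((Finset.univ.erase i : Finset I) : Set I)) (by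
      rintro _ ⟨m, hm, rfl⟩
      exact (hg m (by simpa using Ne.symm (by simpa using hm))).1) (Set.toFinite _)
  rw [hinj.ncard_image, Set.ncard_coe_finset,
    Finset.card_erase_of_mem (Finset.mem_univ _), Finset.card_univ] at h1
  omega

theorem hasFamily_of_same_cell (h : G.IsCellular c ext d) (hI : Fintype.card I = d + 2)
    (hd : 0 < d) {i : I} {S : Set V} (hS : S ⊆ {v | c v = i}) (hne : S.Nonempty)
    (hfam : G.HasFamily {v | c v = i} S (d - 1)) : G.HasFamily univ S d := by
  obtain ⟨T, hT, hTi⟩ := hfam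
  have hext : ∀ s ∈ S, c (ext s) ≠ i := fun s hs h' => h.cell_ext s (h'.trans (hS hs).symm)
  obtain ⟨s₀, hs₀⟩ := hne
  refine (hT.extend (U := fun _ : Unit => {v | c v ≠ i})
    (fun a b hab => absurd (Subsingleton.elim a b) hab)
    (fun _ => Set.disjoint_left.2 fun v hv hvS => hv (hS hvS))
    (fun _ j => Set.disjoint_left.2 fun v hv hvT => hv (hTi j hvT))
    (fun _ => ⟨⟨ext s₀, hext s₀ hs₀, fun v hv => ?_⟩,
      fun s hs => ⟨ext s, hext s hs, h.adj_ext s⟩⟩)).hasFamily ?_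
  · exact (h.connIn_compl hI i ∅ (by simpa using hd) _ (hext s₀ hs₀) v hv (by simp)
      (by simp)).mono sdiff_subset
  · simp only [Fintype.card_sum, Fintype.card_unit, Fintype.card_fin]
    omega

theorem hasFamily_of_two_cells [Finite V] (h : G.IsCellular c ext d)
    (hI : Fintype.card I = d + 2) (hd : 0 < d) {x y z : V} (hxy : x ≠ y) (hc : c x = c y)
    (hz : c z ≠ c x) : G.HasFamily univ {x, y, z} d := by
  classical
  by_cases hadj : G.Adj x y
  · obtain ⟨M, hM, hMC⟩ := (h.conn (c x)).exists_links (x := x) (y := y) (k := d - 1) rfl hc.symm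
      hxy (Or.inr ⟨by omega, h.lt_ncard_cell hI _⟩)
    choose hMC hMconn hxM y' hy' hyy' using hMC
    choose u huM hxu using hxM
    let e : Option (Fin (d - 1)) → V := fun o => ext (o.elim x u)
    have he : Function.Injective e := by
      refine h.ext_injective.comp ?_
      have hux : ∀ l, u l ≠ x := fun l hl => (hMC l (huM l)).2 (by simp [hl])
      rintro (_ | l) (_ | m) hlm
      · rfl
      · exact absurd hlm.symm (hux m)
      · exact absurd hlm (hux l)
      · by_contra hne
        have hlm : u l = u m := hlm
        exact Set.disjoint_left.1 (hM (fun h => hne (congrArg some h))) (huM l) (hlm ▸ huM m)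
    obtain ⟨F, hFd, hF⟩ := (h.connIn_compl hI (c x)).exists_fan (x := z) hz Finset.univ e
      he.injOn (by
        rintro (_ | l) -
        · exact h.cell_ext x
        · exact fun h' => h.cell_ext (u l) (h'.trans (hMC l (huM l)).1.symm))
      (Finset.card_erase_le.trans (Finset.card_image_le.trans (by simp; omega)))
    have hFz : ∀ o, ∀ v ∈ F o, c v ≠ c x ∧ v ≠ z := fun o v hv => (hF o (Finset.mem_univ _)).1 hv
    have hMx : ∀ l, ∀ v ∈ M l, c v = c x ∧ v ≠ x ∧ v ≠ y := fun l v hv =>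
      ⟨(hMC l hv).1, by simpa using (hMC l hv).2⟩
    have hFF : ∀ o o' v, v ∈ F o → v ∈ F o' → o = o' := by
      intro o o' v hv hv'
      by_contra hne
      exact Set.disjoint_left.1 (hFd o (Finset.mem_univ _) o' (Finset.mem_univ _) hne) hv hv'
    obtain ⟨hW, w, hw, hzw⟩ := (hF none (Finset.mem_univ _)).2.connSet_union
      (M := {x} ∪ {y}) ((ConnSet.singleton x).union_of_adj (ConnSet.singleton y) rfl rfl hadj)
      (m := x) (Or.inl rfl) (h.adj_ext x)
    have hW' := hW.union_of_adj (ConnSet.singleton z) hw rfl hzw.symm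
    refine ((hW'.isConnectedFamily_induce (S := {x, y, z}) ?_).extend
      (U := fun l => M l ∪ F (some l)) ?_ ?_ ?_ ?_).hasFamily ?_
    · rintro v (rfl | rfl | rfl) <;> simp
    · intro l m hlm
      refine Set.disjoint_left.2 ?_
      rintro v (hv | hv) (hv' | hv')
      · exact Set.disjoint_left.1 (hM hlm) hv hv'
      · exact (hFz _ v hv').1 (hMx _ v hv).1
      · exact (hFz _ v hv).1 (hMx _ v hv').1
      · exact hlm (Option.some.inj (hFF _ _ v hv hv'))
    · intro l
      refine Set.disjoint_left.2 ?_
      rintro v (hv | hv) (rfl | rfl | rfl)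
      · exact (hMx _ _ hv).2.1 rfl
      · exact (hMx _ _ hv).2.2 rfl
      · exact hz (hMx _ _ hv).1
      · exact (hFz _ _ hv).1 rfl
      · exact (hFz _ _ hv).1 hc.symm
      · exact (hFz _ _ hv).2 rfl
    · intro l _
      refine Set.disjoint_left.2 ?_
      rintro v (hv | hv) (((rfl | rfl) | hv') | rfl)
      · exact (hMx _ _ hv).2.1 rfl
      · exact (hMx _ _ hv).2.2 rfl
      · exact (hFz _ _ hv').1 (hMx _ _ hv).1
      · exact hz (hMx _ _ hv).1
      · exact (hFz _ _ hv).1 rfl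
      · exact (hFz _ _ hv).1 hc.symm
      · exact absurd (hFF _ _ v hv hv') (by simp)
      · exact (hFz _ _ hv).2 rfl
    · intro l
      obtain ⟨h1, h2⟩ := (hF (some l) (Finset.mem_univ _)).2.connSet_union (hMconn l) (huM l)
        (h.adj_ext (u l))
      refine ⟨h1, ?_⟩
      rintro s (rfl | rfl | rfl)
      · exact ⟨u l, Or.inl (huM l), hxu l⟩
      · exact ⟨y' l, Or.inl (hy' l), hyy' l⟩
      · exact h2
    · simp only [Fintype.card_sum, Fintype.card_unit, Fintype.card_fin]
      omega
  · obtain ⟨M, hM, hMC⟩ := (h.conn (c x)).exists_links (x := x) (y := y) (k := d) rfl hc.symm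
      hxy (Or.inl ⟨le_rfl, hadj⟩)
    choose hMC hMconn hxM y' hy' hyy' using hMC
    choose u huM hxu using hxM
    have he : Function.Injective (fun l => ext (u l)) := by
      refine h.ext_injective.comp fun l m hlm => ?_
      by_contra hne
      exact Set.disjoint_left.1 (hM hne) (huM l) (hlm ▸ huM m)
    obtain ⟨F, hFd, hF⟩ := (h.connIn_compl hI (c x)).exists_fan (x := z) hz Finset.univ
      (fun l => ext (u l)) he.injOn
      (fun l _ h' => h.cell_ext (u l) (h'.trans (hMC l (huM l)).1.symm))
      (Finset.card_erase_le.trans (Finset.card_image_le.trans (by simp)))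
    have hFz : ∀ o, ∀ v ∈ F o, c v ≠ c x ∧ v ≠ z := fun o v hv => (hF o (Finset.mem_univ _)).1 hv
    have hMx : ∀ l, ∀ v ∈ M l, c v = c x ∧ v ≠ x ∧ v ≠ y := fun l v hv =>
      ⟨(hMC l hv).1, by simpa using (hMC l hv).2⟩
    refine ((IsConnectedFamily.of_isEmpty {x, y, z} (fun e : Empty => e.elim)).extend
      (U := fun l => M l ∪ F l) ?_ ?_ (fun _ e => e.elim) ?_).hasFamily (by simp)
    · intro l m hlm
      refine Set.disjoint_left.2 ?_
      rintro v (hv | hv) (hv' | hv')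
      · exact Set.disjoint_left.1 (hM hlm) hv hv'
      · exact (hFz _ v hv').1 (hMx _ v hv).1
      · exact (hFz _ v hv).1 (hMx _ v hv').1
      · exact Set.disjoint_left.1 (hFd _ (Finset.mem_univ _) _ (Finset.mem_univ _) hlm) hv hv'
    · intro l
      refine Set.disjoint_left.2 ?_
      rintro v (hv | hv) (rfl | rfl | rfl)
      · exact (hMx _ _ hv).2.1 rfl
      · exact (hMx _ _ hv).2.2 rfl
      · exact hz (hMx _ _ hv).1
      · exact (hFz _ _ hv).1 rfl
      · exact (hFz _ _ hv).1 hc.symm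
      · exact (hFz _ _ hv).2 rfl
    · intro l
      obtain ⟨h1, h2⟩ := (hF l (Finset.mem_univ _)).2.connSet_union (hMconn l) (huM l)
        (h.adj_ext (u l))
      refine ⟨h1, ?_⟩
      rintro s (rfl | rfl | rfl)
      · exact ⟨u l, Or.inl (huM l), hxu l⟩
      · exact ⟨y' l, Or.inl (hy' l), hyy' l⟩
      · exact h2

theorem hasFamily_of_three_cells [Finite V] (h : G.IsCellular c ext d)
    (hI : Fintype.card I = d + 2) (hd : 0 < d) {x y z : V} (hxy : c x ≠ c y) (hxz : c x ≠ c z)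
    (hyz : c y ≠ c z) : G.HasFamily univ {x, y, z} d := by
  -- Two cells may be joined by many edges. The gates of `x` and `z` towards the cell of `y` are
  -- prescribed as the partners of the gates chosen there, so that the legs meet along an edge.
  obtain ⟨gy, hgy, hy⟩ := h.exists_gates y
  obtain ⟨gx, hgx, hx⟩ := h.exists_gates (ext (gy (c x)))
  obtain ⟨gz, hgz, hz⟩ := h.exists_gates (ext (gy (c z)))
  rw [h.ext_ext, (hgy _ hxy).1] at hx
  rw [h.ext_ext, (hgy _ hyz.symm).1] at hz
  simp only [(hgy _ hxy).2] at hgx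
  simp only [(hgy _ hyz.symm).2] at hgz
  have hcard2 : ∀ i j : I, i ≠ j → ((Finset.univ.erase i).erase j).card = d := by
    intro i j hij
    rw [Finset.card_erase_of_mem (by simp [hij.symm]), Finset.card_erase_of_mem (Finset.mem_univ _),
      Finset.card_univ]
    omega
  obtain ⟨Fx, hFxd, hFx, hLx⟩ := h.exists_gate_fan (K := (Finset.univ.erase (c x)).erase (c z)) hgx
    (by simp) (Or.inl (hcard2 _ _ hxz).le)
  obtain ⟨Fz, hFzd, hFz, hLz⟩ := h.exists_gate_fan (K := (Finset.univ.erase (c z)).erase (c x)) hgz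
    (by simp) (Or.inl (hcard2 _ _ hxz.symm).le)
  -- `y` needs legs towards all `d + 1` other cells, one more than `x` and `z`. This is why `y` was
  -- made its own gate to the cell of its partner.
  obtain ⟨Fy, hFyd, hFy, hLy⟩ := h.exists_gate_fan (K := Finset.univ.erase (c y)) hgy
    (by simp) (Or.inr ⟨by
      rw [Finset.card_erase_of_mem (Finset.mem_univ _), Finset.card_univ]
      omega, c (ext y), by simpa using h.cell_ext y, hy⟩)
  simp only [Finset.mem_erase, Finset.mem_univ, and_true] at hFxd hFx hLx hFyd hFy hLy hFzd hFz hLz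
  let ι := {m : I // m ∈ ((Finset.univ.erase (c x)).erase (c z)).erase (c y)}
  have hι : ∀ m : ι, m.1 ≠ c x ∧ m.1 ≠ c y ∧ m.1 ≠ c z := by
    rintro ⟨m, hm⟩
    simp only [Finset.mem_erase, Finset.mem_univ, and_true] at hm
    exact ⟨hm.2.2, hm.1, hm.2.1⟩
  -- The special tree runs from `x` through `y` to `z` along the legs between their cells.
  have hW₁ := (hLx (c y) ⟨hyz, hxy.symm⟩).connSet_insert.union_of_adj
    (hLy (c x) hxy).connSet_insert (hLx (c y) ⟨hyz, hxy.symm⟩).mem_insert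
    (hLy (c x) hxy).mem_insert (by rw [hx]; exact (h.adj_ext _).symm)
  have hW₂ := (hLy (c z) hyz.symm).connSet_insert.union_of_adj
    (hLz (c y) ⟨hxy.symm, hyz⟩).connSet_insert (hLy (c z) hyz.symm).mem_insert
    (hLz (c y) ⟨hxy.symm, hyz⟩).mem_insert (by rw [hz]; exact h.adj_ext _)
  have hW := hW₁.union_of_mem hW₂ (a := y) (by simp) (by simp)
  refine ((hW.isConnectedFamily_induce (S := {x, y, z}) ?_).extend
      (U := fun m : ι => (({v | c v = m.1} ∪ Fx m) ∪ Fy m) ∪ Fz m) ?_ ?_ ?_ ?_).hasFamily ?_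
  · rintro v (rfl | rfl | rfl) <;> simp
  · intro m l hml
    have hml' : m.1 ≠ l.1 := fun h => hml (Subtype.ext h)
    obtain ⟨hm1, hm2, hm3⟩ := hι m
    obtain ⟨hl1, hl2, hl3⟩ := hι l
    refine Set.disjoint_left.2 ?_
    rintro v (((hv | hv) | hv) | hv) (((hv' | hv') | hv') | hv') <;> grind
  · intro m
    obtain ⟨hm1, hm2, hm3⟩ := hι m
    refine Set.disjoint_left.2 ?_
    rintro v (((hv | hv) | hv) | hv) (rfl | rfl | rfl) <;> grind
  · intro m _
    obtain ⟨hm1, hm2, hm3⟩ := hι m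
    refine Set.disjoint_left.2 ?_
    rintro v (((hv | hv) | hv) | hv) (((rfl | hv') | (rfl | hv')) | ((rfl | hv') | (rfl | hv'))) <;>
      grind
  · intro m
    obtain ⟨hm1, hm2, hm3⟩ := hι m
    have hcell : G.ConnSet {v | c v = m.1} := by
      obtain ⟨g, hg, -⟩ := h.gate m (c x) hm1
      exact ⟨g, hg, fun v hv => (h.conn m ∅ (by simpa using hd) g hg v hv (by simp) (by simp)).mono
        sdiff_subset⟩
    obtain ⟨h1, a1, ha1, hxa⟩ := (hLx m ⟨hm3, hm1⟩).connSet_union hcell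
      (m := ext (gx m)) (hgx m hm1).2 (h.adj_ext _).symm
    obtain ⟨h2, a2, ha2, hya⟩ := (hLy m hm2).connSet_union h1
      (m := ext (gy m)) (Or.inl (hgy m hm2).2) (h.adj_ext _).symm
    obtain ⟨h3, a3, ha3, hza⟩ := (hLz m ⟨hm1, hm3⟩).connSet_union h2
      (m := ext (gz m)) (Or.inl (Or.inl (hgz m hm3).2)) (h.adj_ext _).symm
    refine ⟨h3, ?_⟩
    rintro s (rfl | rfl | rfl)
    · exact ⟨a1, Or.inl (Or.inl ha1), hxa⟩
    · exact ⟨a2, Or.inl ha2, hya⟩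
    · exact ⟨a3, ha3, hza⟩
  · rw [Fintype.card_sum, Fintype.card_unit, Fintype.card_coe, Finset.card_erase_of_mem
      (by simp [hyz, hxy.symm]), hcard2 _ _ hxz]
    omega

theorem hasFamily [Finite V] (h : G.IsCellular c ext d) (hI : Fintype.card I = d + 2) (hd : 0 < d)
    (hfam : ∀ x y z, x ≠ y → x ≠ z → y ≠ z → c x = c y → c x = c z →
      G.HasFamily {v | c v = c x} {x, y, z} (d - 1))
    {x y z : V} (hxy : x ≠ y) (hxz : x ≠ z) (hyz : y ≠ z) : G.HasFamily univ {x, y, z} d := by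
  by_cases h1 : c x = c y
  · by_cases h2 : c x = c z
    · refine h.hasFamily_of_same_cell hI hd ?_ ⟨x, by simp⟩ (hfam x y z hxy hxz hyz h1 h2)
      rintro v (rfl | rfl | rfl)
      exacts [rfl, h1.symm, h2.symm]
    · exact h.hasFamily_of_two_cells hI hd hxy h1 (Ne.symm h2)
  · by_cases h2 : c x = c z
    · rw [Set.pair_comm y z]
      exact h.hasFamily_of_two_cells hI hd hxz h2 (Ne.symm h1)
    · by_cases h3 : c y = c z
      · rw [Set.insert_comm x y, Set.pair_comm x z]
        exact h.hasFamily_of_two_cells hI hd hyz h3 h1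
      · exact h.hasFamily_of_three_cells hI hd h1 h2 h3

end IsCellular

end SimpleGraph

/-! ### Transport along injective homomorphisms, spanning trees, complete graphs, and the degree
bound. -/

namespace SimpleGraph

variable {V W : Type*} {G : SimpleGraph V} {H : SimpleGraph W}

theorem Joined.map (φ : G →g H) {U : Set V} {a b : V} (h : G.Joined U a b) :
    H.Joined (φ '' U) (φ a) (φ b) := by
  induction h with
  | refl ha => exact Joined.refl (mem_image_of_mem _ ha)
  | tail _ hbc hc ih => exact Joined.tail ih (φ.map_adj hbc) (mem_image_of_mem _ hc)

theorem ConnIn.map {d : ℕ} (h : G.ConnIn univ d) (φ : G →g H) (hφ : Function.Injective φ) :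
    H.ConnIn (range φ) d := by
  classical
  rintro X hX _ ⟨u, rfl⟩ _ ⟨v, rfl⟩ hu hv
  have hcard : (X.preimage φ hφ.injOn).card ≤ X.card := by
    rw [← Finset.card_image_of_injective _ hφ]
    refine Finset.card_le_card fun w hw => ?_
    obtain ⟨a, ha, rfl⟩ := Finset.mem_image.1 hw
    simpa using ha
  refine ((h _ (hcard.trans_lt hX) u trivial v trivial (by simpa using hu)
    (by simpa using hv)).map φ).mono ?_
  rintro _ ⟨w, ⟨-, hw⟩, rfl⟩
  exact ⟨mem_range_self w, by simpa using hw⟩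

theorem HasFamily.map {S : Set V} {r : ℕ} (h : G.HasFamily univ S r) (φ : G →g H)
    (hφ : Function.Injective φ) : H.HasFamily (range φ) (φ '' S) r := by
  obtain ⟨T, ⟨hT, hTT⟩, -⟩ := h
  refine ⟨fun i => (T i).map φ, ⟨fun i => ⟨?_, image_mono (hT i).2⟩, fun i j hij => ⟨?_, ?_⟩⟩,
    fun i => image_subset_range _ _⟩
  · obtain ⟨u₀, hu₀⟩ := (hT i).1.nonempty
    refine ⟨{ preconnected := ?_, nonempty := ⟨⟨φ u₀, mem_image_of_mem _ hu₀⟩⟩ }⟩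
    rintro ⟨_, a, ha, rfl⟩ ⟨_, b, hb, rfl⟩
    exact ((hT i).1.preconnected ⟨a, ha⟩ ⟨b, hb⟩).map
      (G' := ((T i).map φ).coe)
      { toFun := fun v : (T i).verts => ⟨φ v.1, mem_image_of_mem _ v.2⟩
        map_rel' := fun {u v} huv => ⟨u.1, v.1, huv, rfl, rfl⟩ }
  · rintro _ ⟨⟨a, ha, rfl⟩, b, hb, hab⟩
    obtain rfl := hφ hab
    exact mem_image_of_mem _ ((hTT i j hij).1 ⟨ha, hb⟩)
  · rintro _ _ ⟨a, b, hab, rfl, rfl⟩ ⟨a', b', hab', ha, hb⟩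
    obtain rfl := hφ ha
    obtain rfl := hφ hb
    exact (hTT i j hij).2 _ _ hab hab'

/-- A connected family contains a family of trees. -/
theorem IsConnectedFamily.exists_trees {S : Finset V} {r : ℕ} {T : Fin r → G.Subgraph}
    (h : G.IsConnectedFamily S T) : ∃ T' : Fin r → G.Subgraph, IsInternallyDisjointTrees G S T' := by
  have hex : ∀ i, ∃ T' : G.Subgraph, T'.coe.IsTree ∧ T'.verts = (T i).verts ∧
      ∀ u v, T'.Adj u v → (T i).Adj u v := by
    intro i
    obtain ⟨t, ht, htree⟩ := (h.1 i).1.coe.exists_isTree_le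
    let T' : G.Subgraph :=
      { verts := (T i).verts
        Adj := fun u v => ∃ (hu : u ∈ (T i).verts) (hv : v ∈ (T i).verts), t.Adj ⟨u, hu⟩ ⟨v, hv⟩
        adj_sub := fun ⟨hu, hv, huv⟩ => (T i).adj_sub (ht huv)
        edge_vert := fun ⟨hu, _, _⟩ => hu
        symm := ⟨fun _ _ ⟨hu, hv, huv⟩ => ⟨hv, hu, huv.symm⟩⟩ }
    have hcoe : T'.coe = t := by
      ext u v
      exact ⟨fun ⟨_, _, huv⟩ => huv, fun huv => ⟨u.2, v.2, huv⟩⟩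
    exact ⟨T', by rw [hcoe]; exact htree, rfl, fun u v ⟨hu, hv, huv⟩ => ht huv⟩
  choose T' htree hverts hadj using hex
  refine ⟨T', fun i => ⟨htree i, (hverts i).symm ▸ (h.1 i).2⟩, fun i j hij => ⟨?_, ?_⟩⟩
  · rw [hverts, hverts]
    exact Subset.antisymm (h.2 i j hij).1 (subset_inter (h.1 i).2 (h.1 j).2)
  · refine Set.disjoint_left.2 fun e => ?_
    induction e using Sym2.ind with
    | _ u v => exact fun hi hj => (h.2 i j hij).2 u v (hadj i u v hi) (hadj j u v hj)

/-- In a complete graph, the other vertices and one path through `S` give the family. -/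
theorem hasFamily_of_complete [Fintype V] (hG : ∀ u v, u ≠ v → G.Adj u v) {d : ℕ}
    (hd : Fintype.card V = d + 2) {x y z : V} (hxy : x ≠ y) (hxz : x ≠ z) (hyz : y ≠ z) :
    G.HasFamily univ {x, y, z} d := by
  classical
  let S : Finset V := {x, y, z}
  have hS : S.card = 3 := Finset.card_eq_three.2 ⟨x, y, z, hxy, hxz, hyz, rfl⟩
  have hScoe : (S : Set V) = {x, y, z} := by simp [S]
  rw [← hScoe]
  have hconn : G.ConnSet (S : Set V) := by
    refine ⟨x, by simp [S], fun v hv => ?_⟩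
    by_cases hvx : x = v
    · subst hvx
      exact Joined.refl hv
    · exact Joined.of_adj (hG _ _ hvx) (by simp [S]) hv
  refine ((hconn.isConnectedFamily_induce subset_rfl).extend
    (U := fun v : {v // v ∈ Sᶜ} => {v.1}) ?_ ?_ ?_ ?_).hasFamily ?_
  · exact fun i j hij => Set.disjoint_singleton.2 fun h => hij (Subtype.ext h)
  · exact fun i => Set.disjoint_singleton_left.2 (Finset.mem_compl.1 i.2)
  · exact fun i _ => Set.disjoint_singleton_left.2 (Finset.mem_compl.1 i.2)
  · refine fun i => ⟨ConnSet.singleton _, fun s hs => ⟨i, rfl, hG _ _ ?_⟩⟩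
    rintro rfl
    exact Finset.mem_compl.1 i.2 hs
  · have := Finset.card_compl S
    have := Finset.card_le_univ S
    simp only [Fintype.card_sum, Fintype.card_coe, Fintype.card_unit]
    omega

theorem connIn_univ_of_complete (hG : ∀ u v, u ≠ v → G.Adj u v) (d : ℕ) : G.ConnIn univ d := by
  intro X _ u _ v _ hu hv
  by_cases huv : u = v
  · subst huv
    exact Joined.refl ⟨trivial, hu⟩
  · exact Joined.of_adj (hG _ _ huv) ⟨trivial, hu⟩ ⟨trivial, hv⟩

/-- Two adjacent vertices of degree at most `d` and a third vertex admit fewer than `d` trees. -/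
theorem lt_of_isInternallyDisjointTrees [Finite V] {d r : ℕ} {S : Finset V} {x y z : V}
    (hx : (G.neighborSet x).ncard ≤ d) (hy : (G.neighborSet y).ncard ≤ d) (hxy : G.Adj x y)
    (hxz : x ≠ z) (hyz : y ≠ z) (hxS : x ∈ S) (hyS : y ∈ S) (hzS : z ∈ S)
    {T : Fin r → G.Subgraph} (hT : IsInternallyDisjointTrees G S T) : r < d := by
  by_contra! hr
  have hdisj : ∀ i j u v, (T i).Adj u v → (T j).Adj u v → i = j := by
    intro i j u v hi hj
    by_contra hij
    exact Set.disjoint_left.1 (hT.2 i j hij).2 (show s(u, v) ∈ (T i).edgeSet from hi) hj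
  have hconn : ∀ i, (T i).Connected := fun i => ⟨(hT.1 i).1.connected⟩
  -- Each of the `r ≥ d` trees uses an edge at `w`, and these edges are distinct. There are at most
  -- `d` edges at `w`, so each of them is the only edge at `w` of some tree.
  have key : ∀ w, w ∈ S → (G.neighborSet w).ncard ≤ d →
      ∀ v, G.Adj w v → ∃ j, (T j).Adj w v ∧ ∀ v', (T j).Adj w v' → v' = v := by
    intro w hw hwd v hwv
    have hnb : ∀ i, ∃ u, (T i).Adj w u := by
      intro i
      have hwi : w ∈ (T i).verts := (hT.1 i).2 hw
      have : Nontrivial (T i).verts :=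
        ⟨⟨⟨x, (hT.1 i).2 hxS⟩, ⟨y, (hT.1 i).2 hyS⟩, fun h => hxy.ne (congrArg Subtype.val h)⟩⟩
      obtain ⟨u, hu⟩ := (hconn i).preconnected.exists_adj_of_nontrivial ⟨w, hwi⟩
      exact ⟨u, hu⟩
    choose f hf using hnb
    have finj : Function.Injective f := fun i j hij => hdisj i j w (f i) (hf i) (hij ▸ hf j)
    have hrange : range f = G.neighborSet w := by
      refine Set.eq_of_subset_of_ncard_le ?_ ?_ (Set.toFinite _)
      · rintro _ ⟨i, rfl⟩
        exact (T i).adj_sub (hf i)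
      · rw [Set.ncard_range_of_injective finj, Nat.card_fin]
        exact hwd.trans hr
    obtain ⟨j, hj⟩ : v ∈ range f := hrange ▸ hwv
    refine ⟨j, hj ▸ hf j, fun v' hv' => ?_⟩
    obtain ⟨l, hl⟩ : v' ∈ range f := hrange ▸ (T j).adj_sub hv'
    obtain rfl := hdisj l j w v' (hl ▸ hf l) hv'
    rw [← hl, hj]
  obtain ⟨j, hj, hjx⟩ := key x hxS hx y hxy
  obtain ⟨l, hl, hly⟩ := key y hyS hy x hxy.symm
  obtain rfl := hdisj j l x y hj hl.symm
  have hxz' := (hconn j).preconnected ⟨x, (hT.1 j).2 hxS⟩ ⟨z, (hT.1 j).2 hzS⟩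
  rw [reachable_iff_reflTransGen] at hxz'
  have hstay : ∀ v, Relation.ReflTransGen (T j).coe.Adj ⟨x, (hT.1 j).2 hxS⟩ v →
      v.1 = x ∨ v.1 = y := by
    intro v hv
    induction hv with
    | refl => exact Or.inl rfl
    | @tail b c _ hbc ih =>
      have hbc : (T j).Adj b.1 c.1 := hbc
      rcases ih with hb | hb
      · exact Or.inr (hjx _ (hb ▸ hbc))
      · exact Or.inl (hly _ (hb ▸ hbc))
  rcases hstay _ hxz' with h | h
  · exact hxz h.symm
  · exact hyz h.symm

end SimpleGraph

/-! ### The arrangement graph and its cells. -/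

namespace SimpleGraph

/-- The bubble-sort graph on the arrangements of `k` distinct elements of an arbitrary type. -/
def arrangementGraph (α : Type*) (k : ℕ) : SimpleGraph (Fin k ↪ α) where
  Adj a b :=
    (∃ p q : Fin k, q.val = p.val + 1 ∧ a p = b q ∧ a q = b p ∧
      ∀ i : Fin k, i ≠ p → i ≠ q → a i = b i) ∨
    (∃ p : Fin k, p.val = 0 ∧ a p ≠ b p ∧ ∀ i : Fin k, i ≠ p → a i = b i)
  symm := ⟨by
    rintro a b (⟨p, q, hpq, h1, h2, h3⟩ | ⟨p, hp, h1, h2⟩)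
    · exact Or.inl ⟨p, q, hpq, h2.symm, h1.symm, fun i hp hq => (h3 i hp hq).symm⟩
    · exact Or.inr ⟨p, hp, h1.symm, fun i hi => (h2 i hi).symm⟩⟩
  loopless := ⟨by
    rintro a (⟨p, q, hpq, h1, -, -⟩ | ⟨p, -, h1, -⟩)
    · have h := a.injective h1
      rw [h] at hpq
      omega
    · exact h1 rfl⟩

namespace arrangementGraph

variable {α : Type*} {k : ℕ}

/-- Exchange of the symbols at the last two positions. -/
def swapLast (a : Fin (k + 2) ↪ α) : Fin (k + 2) ↪ α :=
  (Equiv.swap (Fin.last k).castSucc (Fin.last (k + 1))).toEmbedding.trans a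

@[simp]
theorem swapLast_apply (a : Fin (k + 2) ↪ α) (i : Fin (k + 2)) :
    swapLast a i = a (Equiv.swap (Fin.last k).castSucc (Fin.last (k + 1)) i) := rfl

theorem swapLast_swapLast (a : Fin (k + 2) ↪ α) : swapLast (swapLast a) = a := by
  ext i
  simp

theorem adj_swapLast (a : Fin (k + 2) ↪ α) :
    (arrangementGraph α (k + 2)).Adj a (swapLast a) := by
  refine Or.inl ⟨(Fin.last k).castSucc, Fin.last (k + 1), by simp, by simp, by simp, ?_⟩
  intro i hp hq
  rw [swapLast_apply, Equiv.swap_apply_of_ne_of_ne hp hq]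

theorem castSucc_last_ne : (Fin.last k).castSucc ≠ Fin.last (k + 1) := (Fin.castSucc_lt_last _).ne

theorem exists_apply_eq [Fintype α] (hk : k + 2 ≤ Fintype.card α) {i j : α} (hij : i ≠ j) :
    ∃ a : Fin (k + 2) ↪ α, a (Fin.last (k + 1)) = i ∧ a (Fin.last k).castSucc = j := by
  classical
  obtain ⟨f⟩ : Nonempty (Fin (k + 2) ↪ α) :=
    Function.Embedding.nonempty_of_card_le (by simpa using hk)
  -- Relabel the symbols of `f` twice: `σ` puts `i` last, and the next transposition puts `j` before
  -- it without moving `i`.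
  let σ := Equiv.swap (f (Fin.last (k + 1))) i
  have hσ : σ (f (Fin.last (k + 1))) = i := Equiv.swap_apply_left _ _
  have hne : i ≠ σ (f (Fin.last k).castSucc) := by
    rw [← hσ]
    exact fun h => castSucc_last_ne (f.injective (σ.injective h)).symm
  refine ⟨f.trans (σ.trans (Equiv.swap (σ (f (Fin.last k).castSucc)) j)).toEmbedding, ?_, ?_⟩
  · simp only [Function.Embedding.trans_apply, Equiv.coe_toEmbedding, Equiv.trans_apply, hσ]
    exact Equiv.swap_apply_of_ne_of_ne hne hij
  · simp only [Function.Embedding.trans_apply, Equiv.coe_toEmbedding, Equiv.trans_apply]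
    exact Equiv.swap_apply_left _ _

/-- Appending the symbol `i`. -/
def append (i : α) (a : Fin (k + 1) ↪ {s : α // s ≠ i}) : Fin (k + 2) ↪ α where
  toFun := Fin.snoc (α := fun _ => α) (fun p => (a p : α)) i
  inj' := by
    intro p q
    refine Fin.lastCases ?_ (fun p => ?_) p <;> refine Fin.lastCases ?_ (fun q => ?_) q
    · simp
    · simpa using fun h => absurd h.symm (a q).2
    · simpa using fun h => absurd h (a p).2
    · simpa using fun h => a.injective (Subtype.ext h)

@[simp]
theorem append_castSucc (i : α) (a : Fin (k + 1) ↪ {s : α // s ≠ i}) (p : Fin (k + 1)) :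
    append i a p.castSucc = a p :=
  Fin.snoc_castSucc (α := fun _ => α) i (fun p => (a p : α)) p

@[simp]
theorem append_last (i : α) (a : Fin (k + 1) ↪ {s : α // s ≠ i}) :
    append i a (Fin.last (k + 1)) = i :=
  Fin.snoc_last (α := fun _ => α) i fun p => (a p : α)

theorem append_injective (i : α) :
    Function.Injective (append i : (Fin (k + 1) ↪ {s : α // s ≠ i}) → _) := by
  intro a b hab
  ext p
  simpa using DFunLike.congr_fun hab p.castSucc

theorem range_append (i : α) : range (append i) =
    {v : Fin (k + 2) ↪ α | v (Fin.last (k + 1)) = i} := by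
  ext v
  constructor
  · rintro ⟨a, rfl⟩
    simp
  · intro hv
    have hv : v (Fin.last (k + 1)) = i := hv
    refine ⟨⟨fun p => ⟨v p.castSucc, fun h => ?_⟩, fun p q hpq => ?_⟩, ?_⟩
    · exact (Fin.castSucc_lt_last p).ne (v.injective (h.trans hv.symm))
    · exact Fin.castSucc_injective _ (v.injective (congrArg Subtype.val hpq))
    · ext p
      refine Fin.lastCases ?_ (fun p => ?_) p
      · simp [hv]
      · rw [append_castSucc]
        rfl

/-- The subgraph of the arrangements ending in `i`. -/
def appendHom (i : α) : arrangementGraph {s : α // s ≠ i} (k + 1) →g arrangementGraph α (k + 2) where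
  toFun := append i
  map_rel' := by
    rintro a b (⟨p, q, hpq, h1, h2, h3⟩ | ⟨p, hp, h1, h2⟩)
    · refine Or.inl ⟨p.castSucc, q.castSucc, by simpa using hpq, by simp [h1], by simp [h2], ?_⟩
      refine Fin.lastCases (by simp) fun r hr hr' => ?_
      simp [h3 r (fun h => hr (h ▸ rfl)) (fun h => hr' (h ▸ rfl))]
    · refine Or.inr ⟨p.castSucc, by simpa using hp, by simpa [Subtype.ext_iff] using h1, ?_⟩
      refine Fin.lastCases (by simp) fun r hr => ?_
      simp [h2 r (fun h => hr (h ▸ rfl))]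

theorem adj_of_ne {a b : Fin 1 ↪ α} (h : a ≠ b) : (arrangementGraph α 1).Adj a b := by
  refine Or.inr ⟨0, rfl, fun h0 => h ?_, fun i hi => absurd (Subsingleton.elim i 0) hi⟩
  ext i
  rw [Subsingleton.elim i 0, h0]

/-- Both claims share one induction, since the trees are built from the connectivity of the cells.
Passing to a cell lowers both the length and the number of symbols by one; the alphabet is a general
type because a cell omits an arbitrary symbol. Length `1` gives the complete graph on `d + 2`
vertices. -/
theorem connIn_and_hasFamily (k d : ℕ) (hkd : k ≤ d) (α : Type*) [Fintype α]
    (hα : Fintype.card α = d + 2) :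
    (arrangementGraph α (k + 1)).ConnIn univ (d + 1) ∧ ∀ x y z, x ≠ y → x ≠ z → y ≠ z →
      (arrangementGraph α (k + 1)).HasFamily univ {x, y, z} d := by
  classical
  induction k generalizing d α with
  | zero =>
    refine ⟨connIn_univ_of_complete (fun _ _ => adj_of_ne) _, fun x y z hxy hxz hyz =>
      hasFamily_of_complete (fun _ _ => adj_of_ne) ?_ hxy hxz hyz⟩
    rw [Fintype.card_embedding_eq, hα]
    simp
  | succ k ih =>
    obtain ⟨e, rfl⟩ : ∃ e, d = e + 1 := ⟨d - 1, by omega⟩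
    have hβ : ∀ i : α, Fintype.card {s : α // s ≠ i} = e + 2 := by
      intro i
      rw [Fintype.card_subtype_compl, hα, Fintype.card_subtype_eq]
      rfl
    have hcell : (arrangementGraph α (k + 2)).IsCellular (fun v => v (Fin.last (k + 1)))
        swapLast (e + 1) :=
      { ext_ext := swapLast_swapLast
        adj_ext := adj_swapLast
        cell_ext := fun v h => by simp at h
        gate := fun i j hij => by
          obtain ⟨a, ha, ha'⟩ := exists_apply_eq (k := k) (by omega) hij
          exact ⟨a, ha, by simpa using ha'⟩
        conn := fun i => by
          rw [← range_append]
          exact (ih e (by omega) _ (hβ i)).1.map (appendHom i) (append_injective i) }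
    refine ⟨hcell.connIn_univ hα (Nat.succ_pos _), fun x y z hxy hxz hyz =>
      hcell.hasFamily hα (Nat.succ_pos _) ?_ hxy hxz hyz⟩
    intro x y z hxy hxz hyz hcy hcz
    set i := x (Fin.last (k + 1)) with hi
    have hx : x ∈ range (append i) := by rw [range_append]; rfl
    have hy : y ∈ range (append i) := by rw [range_append]; exact hcy.symm
    have hz : z ∈ range (append i) := by rw [range_append]; exact hcz.symm
    rw [← range_append]
    obtain ⟨x', hx'⟩ := hx
    obtain ⟨y', hy'⟩ := hy
    obtain ⟨z', hz'⟩ := hz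
    have := ((ih e (by omega) _ (hβ i)).2 x' y' z' (fun h => hxy (by rw [← hx', ← hy', h]))
      (fun h => hxz (by rw [← hx', ← hz', h])) (fun h => hyz (by rw [← hy', ← hz', h]))).map
      (appendHom i) (append_injective i)
    have himg : appendHom i '' {x', y', z'} = {x, y, z} := by
      rw [image_insert_eq, image_pair, ← hx', ← hy', ← hz']
      rfl
    rw [himg] at this
    exact this

/-- Every neighbour of `a` arises by exchanging a symbol `s ≠ a 0` with the symbol `t s` that stands
before `s` in `a`, or with `a 0` if `s` does not occur in `a`. -/
theorem ncard_neighborSet_le [Fintype α] (a : Fin (k + 1) ↪ α) :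
    ((arrangementGraph α (k + 1)).neighborSet a).ncard ≤ Fintype.card α - 1 := by
  classical
  have hpred : ∀ s : α, ∃ t : α, (s ∉ range a → t = a 0) ∧
      ∀ p q : Fin (k + 1), q.val = p.val + 1 → s = a q → t = a p := by
    intro s
    by_cases hs : ∃ p q : Fin (k + 1), q.val = p.val + 1 ∧ s = a q
    · obtain ⟨p, q, hpq, rfl⟩ := hs
      refine ⟨a p, fun h => absurd (mem_range_self q) h, fun p' q' hpq' h => ?_⟩
      obtain rfl := a.injective h
      exact congrArg a (Fin.ext (by omega))
    · exact ⟨a 0, fun _ => rfl, fun p q hpq h => absurd ⟨p, q, hpq, h⟩ hs⟩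
  choose t ht ht' using hpred
  let f : α → (Fin (k + 1) ↪ α) := fun s => a.trans (Equiv.swap (t s) s).toEmbedding
  have hsub : (arrangementGraph α (k + 1)).neighborSet a ⊆ ((Finset.univ.erase (a 0)).image f :
      Finset (Fin (k + 1) ↪ α)) := by
    rintro b (⟨p, q, hpq, h1, h2, h3⟩ | ⟨p, hp, h1, h2⟩)
    · refine Finset.mem_coe.2 (Finset.mem_image.2 ⟨a q, ?_, ?_⟩)
      · refine Finset.mem_erase.2 ⟨fun h => ?_, Finset.mem_univ _⟩
        have := congrArg Fin.val (a.injective h)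
        simp [hpq] at this
      · have htq := ht' (a q) p q hpq rfl
        ext r
        change Equiv.swap (t (a q)) (a q) (a r) = b r
        rw [htq]
        by_cases hrp : r = p
        · rw [hrp, Equiv.swap_apply_left, h2]
        by_cases hrq : r = q
        · rw [hrq, Equiv.swap_apply_right, h1]
        rw [Equiv.swap_apply_of_ne_of_ne (a.injective.ne hrp) (a.injective.ne hrq), h3 r hrp hrq]
    · obtain rfl : p = 0 := Fin.ext hp
      have hb : b 0 ∉ range a := by
        rintro ⟨r, hr⟩
        by_cases hr0 : r = 0
        · exact h1 (hr0 ▸ hr)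
        · exact hr0 (b.injective ((h2 r hr0).symm.trans hr))
      refine Finset.mem_coe.2 (Finset.mem_image.2 ⟨b 0, ?_, ?_⟩)
      · exact Finset.mem_erase.2 ⟨h1.symm, Finset.mem_univ _⟩
      · have htq := ht (b 0) hb
        ext r
        change Equiv.swap (t (b 0)) (b 0) (a r) = b r
        rw [htq]
        by_cases hrp : r = 0
        · rw [hrp, Equiv.swap_apply_left]
        rw [Equiv.swap_apply_of_ne_of_ne (a.injective.ne hrp) (fun h => hb ⟨r, h⟩), h2 r hrp]
  refine (Set.ncard_le_ncard hsub (Finset.finite_toSet _)).trans ?_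
  rw [Set.ncard_coe_finset]
  refine Finset.card_image_le.trans ?_
  rw [Finset.card_erase_of_mem (Finset.mem_univ _), Finset.card_univ]

end arrangementGraph

theorem bubbleSortGraph_eq (n k : ℕ) : bubbleSortGraph n k = arrangementGraph (Fin n) k := rfl

end SimpleGraph

/-! ### The theorem. -/

theorem theorem2 (n k : ℕ) (hk : 3 ≤ k) (hkn : k ≤ n - 1) :
    generalizedConnectivity 3 (bubbleSortGraph n k) = ((n - 2 : ℕ) : ℕ∞) := by
  obtain ⟨m, rfl⟩ : ∃ m, k = m + 2 := ⟨k - 2, by omega⟩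
  rw [SimpleGraph.bubbleSortGraph_eq]
  refine le_antisymm ?_ ?_
  · obtain ⟨x⟩ : Nonempty (Fin (m + 2) ↪ Fin n) :=
      Function.Embedding.nonempty_of_card_le (by simp; omega)
    have hxy := SimpleGraph.arrangementGraph.adj_swapLast x
    set y := SimpleGraph.arrangementGraph.swapLast x
    -- A third last symbol makes `z` distinct from `x` and `y`; nothing else is needed of `z`.
    obtain ⟨i, -, hi⟩ := Finset.exists_mem_notMem_of_card_lt_card
      (s := {x (Fin.last (m + 1)), y (Fin.last (m + 1))}) (t := (Finset.univ : Finset (Fin n)))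
      (Finset.card_le_two.trans_lt (by rw [Finset.card_univ, Fintype.card_fin]; omega))
    have hix : i ≠ x (Fin.last (m + 1)) := fun h => hi (by simp [h])
    have hiy : i ≠ y (Fin.last (m + 1)) := fun h => hi (by simp [h])
    obtain ⟨z, hz, -⟩ := SimpleGraph.arrangementGraph.exists_apply_eq (k := m)
      (by simp; omega) hix
    have hzx : x ≠ z := fun h => hix (by rw [h, hz])
    have hzy : y ≠ z := fun h => hiy (by rw [h, hz])
    refine (iInf₂_le {x, y, z} (Finset.card_eq_three.2 ⟨x, y, z, hxy.ne, hzx, hzy, rfl⟩)).trans ?_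
    refine iSup₂_le fun r ⟨T, hT⟩ => ?_
    have := SimpleGraph.lt_of_isInternallyDisjointTrees (d := n - 1)
      (by simpa using SimpleGraph.arrangementGraph.ncard_neighborSet_le x)
      (by simpa using SimpleGraph.arrangementGraph.ncard_neighborSet_le y)
      hxy hzx hzy (by simp) (by simp) (by simp) hT
    exact_mod_cast (by omega : r ≤ n - 2)
  · refine le_iInf₂ fun S hS => ?_
    obtain ⟨x, y, z, hxy, hxz, hyz, rfl⟩ := Finset.card_eq_three.1 hS
    obtain ⟨T, hT, -⟩ := (SimpleGraph.arrangementGraph.connIn_and_hasFamily (m + 1) (n - 2)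
      (by omega) (Fin n) (by simp; omega)).2 x y z hxy hxz hyz
    have hcoe : (({x, y, z} : Finset (Fin (m + 2) ↪ Fin n)) : Set _) = {x, y, z} := by simp
    rw [← hcoe] at hT
    exact le_iSup₂_of_le (n - 2) hT.exists_trees le_rfl
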